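/- For a finite simple graph $G=(V,E)$ let $\mathrm{LPVC}(G)$ be the linear program that minimizes $\sum_{v\in V}x(v)$ over all $x:V\to\mathbb R_{\ge 0}$ with $x(u)+x(v)\ge 1$ for every edge $uv\in E$, and let $vc^*(G)$ be its minimum value. An instance of Vertex Cover is a pair $(G,k)$ with $k\in\mathbb N$; it is a yes-instance if $G$ has a vertex cover of size at most $k$. Logarithms are to base $2$. For every fixed real constant $c$ there is an algorithm that, on input $(G,k)$, runs in time polynomial in $|V(G)|+\log k$ (in the size of the input) and returns an instance $(G',k')$ such that, for every graph $G$ and every integer $k\ge 1$: 1. $(G,k)$ is a yes-instance if and only if $(G',k')$ is a yes-instance; 2. $k'\le k$ and $|V(G')|\le\max\{2,\;2k-c\log k\}$; 3. either the instance has been solved, meaning that $k'=0$ and $|V(G')|\le 2$, or else the all-$\tfrac12$ vector is the unique optimum solution of $\mathrm{LPVC}(G')$, $|V(G')|=2\,vc^*(G')$, and $k'-vc^*(G')>\tfrac c2\log k$ (so that $|V(G')|=2\,vc^*(G')<2(k'-\tfrac c2\log k)\le 2k-c\log k$); 4. if $k-vc^*(G)\le \tfrac c2\log k$, then the instance is solved,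 in the sense of 3. For $c=2$ the threshold is $\log k$ and the bound in 3 is $|V(G')|=2\,vc^*(G')\le 2(k'-\log k)\le 2k-2\log k$. -/

import Mathlib

namespace VCKernel

/-! ### Random access machine programs with a step count -/

/-- Memory of a random access machine: scalar registers and arrays, all holding natural numbers.
A program is a finite piece of syntax, so it accesses only finitely many registers and arrays. -/
structure State where
  var : ℕ → ℕ
  arr : ℕ → ℕ → ℕ

/-- Expressions: constants, registers, (indirectly addressed) array cells, sums and truncated
differences. There is no multiplication, so that counting every operation as one step is
polynomially equivalent to counting Turing machine steps. -/
inductive Expr where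
  | const (c : ℕ)
  | var (x : ℕ)
  | get (a : ℕ) (i : Expr)
  | add (e₁ e₂ : Expr)
  | sub (e₁ e₂ : Expr)

/-- The value of an expression. -/
def Expr.eval (s : State) : Expr → ℕ
  | .const c => c
  | .var x => s.var x
  | .get a i => s.arr a (i.eval s)
  | .add e₁ e₂ => e₁.eval s + e₂.eval s
  | .sub e₁ e₂ => e₁.eval s - e₂.eval s

/-- The number of steps needed to evaluate an expression: one for each of its nodes. -/
def Expr.cost : Expr → ℕ
  | .const _ => 1
  | .var _ => 1
  | .get _ i => i.cost + 1
  | .add e₁ e₂ => e₁.cost + e₂.cost + 1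
  | .sub e₁ e₂ => e₁.cost + e₂.cost + 1

/-- Programs. -/
inductive Prog where
  | skip
  | assign (x : ℕ) (e : Expr)
  | store (a : ℕ) (i e : Expr)
  | seq (p q : Prog)
  | ite (e : Expr) (p q : Prog)
  | loop (e : Expr) (p : Prog)

/-- `Exec p s t s'`: started in memory `s`, the program `p` halts after exactly `t` steps, in
memory `s'`. A test `e` succeeds if the value of `e` is nonzero; `loop e p` is
"while `e` do `p`". -/
inductive Exec : Prog → State → ℕ → State → Prop where
  | skip (s : State) : Exec .skip s 1 s
  | assign (x : ℕ) (e : Expr) (s : State) :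
      Exec (.assign x e) s (e.cost + 1)
        { s with var := Function.update s.var x (e.eval s) }
  | store (a : ℕ) (i e : Expr) (s : State) :
      Exec (.store a i e) s (i.cost + e.cost + 1)
        { s with arr := Function.update s.arr a
                  (Function.update (s.arr a) (i.eval s) (e.eval s)) }
  | seq {p q : Prog} {s s' s'' : State} {t t' : ℕ} :
      Exec p s t s' → Exec q s' t' s'' → Exec (.seq p q) s (t + t') s''
  | ite_true {e : Expr} {p q : Prog} {s s' : State} {t : ℕ} :
      e.eval s ≠ 0 → Exec p s t s' → Exec (.ite e p q) s (e.cost + 1 + t) s'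
  | ite_false {e : Expr} {p q : Prog} {s s' : State} {t : ℕ} :
      e.eval s = 0 → Exec q s t s' → Exec (.ite e p q) s (e.cost + 1 + t) s'
  | loop_true {e : Expr} {p : Prog} {s s' s'' : State} {t t' : ℕ} :
      e.eval s ≠ 0 → Exec p s t s' → Exec (.loop e p) s' t' s'' →
      Exec (.loop e p) s (e.cost + 1 + t + t') s''
  | loop_false {e : Expr} {p : Prog} {s : State} :
      e.eval s = 0 → Exec (.loop e p) s (e.cost + 1) s

/-! ### Instances of Vertex Cover -/

/-- A pair `(G, k)` of a finite graph, on the vertices `0, …, n - 1`, and a number `k`. -/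
structure Instance where
  n : ℕ
  G : SimpleGraph (Fin n)
  k : ℕ

/-- `G` has a vertex cover of size at most `k`. -/
def Instance.IsYes (I : Instance) : Prop :=
  ∃ S : Finset (Fin I.n), I.G.IsVertexCover (S : Set (Fin I.n)) ∧ S.card ≤ I.k

/-- The size of the input `(G, k)`: the number of vertices plus the number of binary digits
of `k`. -/
def Instance.size (I : Instance) : ℕ := I.n + Nat.size I.k

open Classical in
/-- The initial memory on input `(G, k)`: `n` in register 0, `k` in register 1, the adjacency
matrix of `G`, row by row, in the first `n * n` cells of array 0, and zeros everywhere else. -/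
noncomputable def Instance.input (I : Instance) : State where
  var x := if x = 0 then I.n else if x = 1 then I.k else 0
  arr a m := if a = 0 ∧ ∃ i j : Fin I.n, I.G.Adj i j ∧ m = i * I.n + j then 1 else 0

open Classical in
/-- The memory `s` contains `(G, k)`, in the same format, as an output. -/
def Instance.IsOutput (I : Instance) (s : State) : Prop :=
  s.var 0 = I.n ∧ s.var 1 = I.k ∧
    ∀ i j : Fin I.n, s.arr 0 (i * I.n + j) = if I.G.Adj i j then 1 else 0

/-- The map `f` on instances is computed by a program that halts after a number of steps that is
polynomial in the size of the input. -/
def PolyTimeComputable (f : Instance → Instance) : Prop :=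
  ∃ (P : Prog) (p : Polynomial ℕ), ∀ I : Instance,
    ∃ (t : ℕ) (s : State), Exec P I.input t s ∧ t ≤ p.eval I.size ∧ (f I).IsOutput s

/-! ### The linear programming relaxation of Vertex Cover -/

section LP

variable {V : Type*} [Fintype V]

/-- `x` is a feasible solution of LPVC(`G`). -/
def LPFeasible (G : SimpleGraph V) (x : V → ℝ) : Prop :=
  (∀ v, 0 ≤ x v) ∧ ∀ u v, G.Adj u v → 1 ≤ x u + x v

/-- `x` is an optimum solution of LPVC(`G`). -/
def LPOptimal (G : SimpleGraph V) (x : V → ℝ) : Prop :=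
  LPFeasible G x ∧ ∀ y, LPFeasible G y → ∑ v, x v ≤ ∑ v, y v

/-- `vc*(G)`, the minimum value of LPVC(`G`). -/
noncomputable def vcStar (G : SimpleGraph V) : ℝ :=
  sInf {w : ℝ | ∃ x : V → ℝ, LPFeasible G x ∧ w = ∑ v, x v}

/-- The all-`1/2` solution is the unique optimum solution of LPVC(`G`). -/
def UniqueHalf (G : SimpleGraph V) : Prop :=
  ∀ x : V → ℝ, LPOptimal G x ↔ x = fun _ => 1 / 2

end LP

end VCKernel

/-! The proof follows the gap k − vc*(G). Write opt for `halfOpt`, twice the least value of a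
half-integral solution. A matching of size opt in the bipartite double cover bounds every real
solution from below (`IsDoubleMatching.card_le`), so its existence gives vc* = opt/2.

A vertex is reducible if giving it the value 0 and its neighbours the value 1 is compatible with
optimality. Persistency in the manner of Nemhauser and Trotter (`Reducible.exists_covers`) allows
these neighbours to be put into the cover. Then k and vc* drop by the same number, so the gap is
unchanged. If no vertex is reducible, no optimum half-integral solution has a zero. Hence opt is the
number of vertices, and the all-1/2 vector is the only optimum (`eq_half_of_irreducible`).

In an irreducible graph, branching on any vertex (take it, or take its neighbours) lowers twice the
gap by at least 1 on either side. Twice the gap never becomes negative along choices that follow an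
actual cover, so d = 2k − opt binary choices suffice (`exists_bits`). Let the threshold for d be C
times the number of binary digits of k, where C ≥ |c|. Below the threshold there are at most (2k +
1)^C choice sequences, and 2k ≤ n + threshold makes this polynomial in the input size: all of them
are tried and the instance is solved. Above the threshold, reduction alone yields the kernel. Its
gap is still above the threshold, and it has exactly 2 vc* vertices.

The number opt is computed by an auction on the double cover with integer prices between 0 and n.
Once bidding stops, a price level that no vertex has separates off a fractional cover of the same
value as the matching (`AuctionInv.final`). The algorithm is an explicit program. All loops but one
are `for` loops bounded by registers that the surrounding program leaves alone, so their polynomial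
running time is read off the syntax (`exec_compile`). -/

namespace VCKernel

/-! ### Programs with bounded loops -/

/-- Memory with register `x` set to `v`. -/
def State.setVar (s : State) (x v : ℕ) : State :=
  { s with var := Function.update s.var x v }

/-- Memory with cell `i` of array `a` set to `v`. -/
def State.setArr (s : State) (a i v : ℕ) : State :=
  { s with arr := Function.update s.arr a (Function.update (s.arr a) i v) }

@[simp] theorem State.var_setVar (s : State) (x v y : ℕ) :
    (s.setVar x v).var y = if y = x then v else s.var y := by
  simp [State.setVar, Function.update_apply]

@[simp] theorem State.arr_setVar (s : State) (x v : ℕ) : (s.setVar x v).arr = s.arr := rfl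

@[simp] theorem State.var_setArr (s : State) (a i v : ℕ) : (s.setArr a i v).var = s.var := rfl

@[simp] theorem State.arr_setArr (s : State) (a i v b : ℕ) :
    (s.setArr a i v).arr b = if b = a then Function.update (s.arr a) i v else s.arr b := by
  simp only [State.setArr, Function.update_apply]

/-- Programs in which every loop is a `for` loop: `forLoop r x p` runs `p` for
`x = 0, 1, …` as long as `x` is less than the register `r`. -/
inductive ForProg where
  | skip
  | assign (x : ℕ) (e : Expr)
  | store (a : ℕ) (i e : Expr)
  | seq (p q : ForProg)
  | ite (e : Expr) (p q : ForProg)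
  | forLoop (r x : ℕ) (p : ForProg)

namespace ForProg

/-- The memory after the execution of a program. -/
def run : ForProg → State → State
  | skip, s => s
  | assign x e, s => s.setVar x (e.eval s)
  | store a i e, s => s.setArr a (i.eval s) (e.eval s)
  | seq p q, s => q.run (p.run s)
  | ite e p q, s => if e.eval s ≠ 0 then p.run s else q.run s
  | forLoop r x p, s =>
      (fun s' => (p.run s').setVar x ((p.run s').var x + 1))^[s.var r] (s.setVar x 0)

@[simp] theorem run_seq (p q : ForProg) (s : State) : (seq p q).run s = q.run (p.run s) := rfl

theorem run_ite_pos {e : Expr} {p q : ForProg} {s : State} (h : e.eval s ≠ 0) :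
    (ite e p q).run s = p.run s := by
  rw [run, if_pos h]

theorem run_ite_neg {e : Expr} {p q : ForProg} {s : State} (h : e.eval s = 0) :
    (ite e p q).run s = q.run s := by
  rw [run, if_neg (not_not.2 h)]

/-- The translation into the language of random access machines. -/
def compile : ForProg → Prog
  | skip => .skip
  | assign x e => .assign x e
  | store a i e => .store a i e
  | seq p q => .seq p.compile q.compile
  | ite e p q => .ite e p.compile q.compile
  | forLoop r x p =>
      .seq (.assign x (.const 0))
        (.loop (.sub (.var r) (.var x))
          (.seq p.compile (.assign x (.add (.var x) (.const 1)))))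

/-- Whether a program may change register `y`. -/
def writesVar : ForProg → ℕ → Bool
  | skip, _ => false
  | assign x _, y => x == y
  | store _ _ _, _ => false
  | seq p q, y => p.writesVar y || q.writesVar y
  | ite _ p q, y => p.writesVar y || q.writesVar y
  | forLoop _ x p, y => x == y || p.writesVar y

/-- Whether a program may change array `b`. -/
def writesArr : ForProg → ℕ → Bool
  | skip, _ => false
  | assign _ _, _ => false
  | store a _ _, b => a == b
  | seq p q, b => p.writesArr b || q.writesArr b
  | ite _ p q, b => p.writesArr b || q.writesArr b
  | forLoop _ _ p, b => p.writesArr b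

/-- The registers that bound the loops of a program. -/
def bounds : ForProg → List ℕ
  | seq p q => p.bounds ++ q.bounds
  | ite _ p q => p.bounds ++ q.bounds
  | forLoop r _ p => r :: p.bounds
  | _ => []

/-- No loop counter is changed by the body of its loop. -/
def countersOk : ForProg → Bool
  | seq p q => p.countersOk && q.countersOk
  | ite _ p q => p.countersOk && q.countersOk
  | forLoop _ x p => !p.writesVar x && p.countersOk
  | _ => true

/-- An upper bound on the number of steps, as a polynomial in an upper bound on the registers
that bound the loops. -/
noncomputable def time : ForProg → Polynomial ℕ
  | skip => 1
  | assign _ e => (e.cost + 1 : ℕ)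
  | store _ i e => (i.cost + e.cost + 1 : ℕ)
  | seq p q => p.time + q.time
  | ite e p q => (e.cost + 1 : ℕ) + p.time + q.time
  | forLoop _ _ p => 6 + Polynomial.X * (p.time + 8)

/-- `s'` differs from `s` at most in the registers and arrays that `p` may change. -/
def Frame (p : ForProg) (s s' : State) : Prop :=
  (∀ y, p.writesVar y = false → s'.var y = s.var y) ∧
    ∀ a, p.writesArr a = false → s'.arr a = s.arr a

theorem frame_iterate {r x : ℕ} {p : ForProg} (hp : ∀ s, p.Frame s (p.run s)) (s : State)
    (m : ℕ) : (forLoop r x p).Frame s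
      ((fun s' => (p.run s').setVar x ((p.run s').var x + 1))^[m] (s.setVar x 0)) := by
  induction m with
  | zero =>
    refine ⟨fun y hy => ?_, fun a _ => rfl⟩
    simp only [writesVar, Bool.or_eq_false_iff, beq_eq_false_iff_ne] at hy
    simp [Ne.symm hy.1]
  | succ m ih =>
    rw [Function.iterate_succ_apply']
    refine ⟨fun y hy => ?_, fun a ha => ?_⟩
    · have hy' := hy
      simp only [writesVar, Bool.or_eq_false_iff, beq_eq_false_iff_ne] at hy'
      simp only [State.var_setVar, Ne.symm hy'.1, if_false]
      rw [(hp _).1 y hy'.2, ih.1 y hy]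
    · have ha' := ha
      simp only [writesArr] at ha'
      simp only [State.arr_setVar]
      rw [(hp _).2 a ha', ih.2 a ha]

/-- Writes are tracked syntactically by Boolean functions. For a concrete program and register the
side condition `writesVar … = false` is therefore closed by `rfl`. -/
theorem frame_run (p : ForProg) (s : State) : p.Frame s (p.run s) := by
  induction p generalizing s with
  | skip => exact ⟨fun _ _ => rfl, fun _ _ => rfl⟩
  | assign x e =>
    refine ⟨fun y hy => ?_, fun _ _ => rfl⟩
    simp only [writesVar, beq_eq_false_iff_ne] at hy
    simp [run, Ne.symm hy]
  | store a i e =>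
    refine ⟨fun _ _ => rfl, fun b hb => ?_⟩
    simp only [writesArr, beq_eq_false_iff_ne] at hb
    simp [run, Ne.symm hb]
  | seq p q hp hq =>
    refine ⟨fun y hy => ?_, fun a ha => ?_⟩
    · simp only [writesVar, Bool.or_eq_false_iff] at hy
      rw [run, (hq _).1 y hy.2, (hp _).1 y hy.1]
    · simp only [writesArr, Bool.or_eq_false_iff] at ha
      rw [run, (hq _).2 a ha.2, (hp _).2 a ha.1]
  | ite e p q hp hq =>
    refine ⟨fun y hy => ?_, fun a ha => ?_⟩
    · simp only [writesVar, Bool.or_eq_false_iff] at hy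
      rw [run]
      split_ifs
      exacts [(hp _).1 y hy.1, (hq _).1 y hy.2]
    · simp only [writesArr, Bool.or_eq_false_iff] at ha
      rw [run]
      split_ifs
      exacts [(hp _).2 a ha.1, (hq _).2 a ha.2]
  | forLoop r x p hp => exact frame_iterate hp s _

theorem var_run {p : ForProg} {y : ℕ} (h : p.writesVar y = false) (s : State) :
    (p.run s).var y = s.var y := (frame_run p s).1 y h

theorem arr_run {p : ForProg} {a : ℕ} (h : p.writesArr a = false) (s : State) :
    (p.run s).arr a = s.arr a := (frame_run p s).2 a h

theorem counter_iterate {x : ℕ} {p : ForProg} (hx : p.writesVar x = false) (s : State)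
    (m : ℕ) :
    ((fun s' => (p.run s').setVar x ((p.run s').var x + 1))^[m] (s.setVar x 0)).var x = m := by
  induction m with
  | zero => simp
  | succ m ih =>
    rw [Function.iterate_succ_apply']
    simp only [State.var_setVar, if_true]
    rw [var_run hx, ih]

/-- Reasoning about `for` loops by means of an invariant. -/
theorem run_forLoop {r x : ℕ} {p : ForProg} {s : State} (hx : p.writesVar x = false)
    (Inv : ℕ → State → Prop) (h0 : Inv 0 (s.setVar x 0))
    (hs : ∀ i s', i < s.var r → s'.var x = i → (forLoop r x p).Frame s s' → Inv i s' →
      Inv (i + 1) ((p.run s').setVar x (i + 1))) :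
    Inv (s.var r) ((forLoop r x p).run s) := by
  rw [run]
  suffices h : ∀ m, m ≤ s.var r → Inv m
      ((fun s' => (p.run s').setVar x ((p.run s').var x + 1))^[m] (s.setVar x 0)) from
    h _ le_rfl
  intro m
  induction m with
  | zero => exact fun _ => h0
  | succ m ih =>
    intro hm
    have hc := counter_iterate hx s m
    have := hs m _ (by omega) hc (frame_iterate (frame_run p) s m) (ih (by omega))
    rw [Function.iterate_succ_apply']
    rwa [var_run hx, hc]

/-- No bounding register is written anywhere in `p`, so a bound by `B` on entry persists into nested
loops, and every loop makes exactly the number of iterations prescribed by `run`. -/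
theorem exec_compile (p : ForProg) (s : State) (B : ℕ) (hc : p.countersOk = true)
    (hb : ∀ r ∈ p.bounds, p.writesVar r = false ∧ s.var r ≤ B) :
    ∃ t ≤ p.time.eval B, Exec p.compile s t (p.run s) := by
  induction p generalizing s with
  | skip => exact ⟨1, by simp [time], Exec.skip s⟩
  | assign x e => exact ⟨_, by simp [time, -Nat.cast_add], Exec.assign x e s⟩
  | store a i e => exact ⟨_, by simp [time, -Nat.cast_add], Exec.store a i e s⟩
  | seq p q hp hq =>
    simp only [countersOk, Bool.and_eq_true] at hc
    simp only [bounds, List.mem_append, writesVar, Bool.or_eq_false_iff] at hb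
    obtain ⟨t, ht, h⟩ := hp s hc.1 fun r hr => ⟨(hb r (.inl hr)).1.1, (hb r (.inl hr)).2⟩
    obtain ⟨t', ht', h'⟩ := hq (p.run s) hc.2 fun r hr => by
      have := hb r (.inr hr)
      exact ⟨this.1.2, by rw [var_run this.1.1]; exact this.2⟩
    exact ⟨t + t', by simp only [time, Polynomial.eval_add]; omega, h.seq h'⟩
  | ite e p q hp hq =>
    simp only [countersOk, Bool.and_eq_true] at hc
    simp only [bounds, List.mem_append, writesVar, Bool.or_eq_false_iff] at hb
    obtain ⟨t, ht, h⟩ := hp s hc.1 fun r hr => ⟨(hb r (.inl hr)).1.1, (hb r (.inl hr)).2⟩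
    obtain ⟨t', ht', h'⟩ := hq s hc.2 fun r hr => ⟨(hb r (.inr hr)).1.2, (hb r (.inr hr)).2⟩
    by_cases he : e.eval s = 0
    · refine ⟨e.cost + 1 + t', ?_, ?_⟩
      · simp only [time, Polynomial.eval_add, Polynomial.eval_natCast, Nat.cast_id]; omega
      · simp only [run, he, ne_eq, not_true_eq_false, if_false]; exact .ite_false he h'
    · refine ⟨e.cost + 1 + t, ?_, ?_⟩
      · simp only [time, Polynomial.eval_add, Polynomial.eval_natCast, Nat.cast_id]; omega
      · simp only [run, he, ne_eq, not_false_eq_true, if_true]; exact .ite_true he h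
  | forLoop r x p hp =>
    simp only [countersOk, Bool.and_eq_true, Bool.not_eq_true'] at hc
    simp only [bounds, List.mem_cons, writesVar, Bool.or_eq_false_iff,
      beq_eq_false_iff_ne] at hb
    have hr := hb r (.inl rfl)
    set f : State → State := fun s' => (p.run s').setVar x ((p.run s').var x + 1) with hf
    -- The induction is on the number `m` of iterations still to come, because `Exec.loop_true`
    -- unrolls a loop from the front. An iteration costs 4 for the test and 4 for the increment
    -- besides the body; the final failing test costs 4.
    have key : ∀ m, m ≤ s.var r → ∃ t ≤ m * (p.time.eval B + 8) + 4,
        Exec (.loop (.sub (.var r) (.var x))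
          (.seq p.compile (.assign x (.add (.var x) (.const 1)))))
          (f^[s.var r - m] (s.setVar x 0)) t (f^[s.var r] (s.setVar x 0)) := by
      have hfr (j : ℕ) : (f^[j] (s.setVar x 0)).var r = s.var r :=
        (frame_iterate (r := r) (frame_run p) s j).1 r (by simp [writesVar, hr.1])
      have hfx (j : ℕ) : (f^[j] (s.setVar x 0)).var x = j := counter_iterate hc.1 s j
      intro m
      induction m with
      | zero =>
        intro _
        refine ⟨4, by simp, ?_⟩
        exact Exec.loop_false (by simp [Expr.eval, hfr, hfx])
      | succ m ih =>
        intro hm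
        obtain ⟨t, ht, h⟩ := ih (by omega)
        have e1 : s.var r - m = (s.var r - (m + 1)) + 1 := by omega
        rw [e1, Function.iterate_succ_apply'] at h
        set s1 := f^[s.var r - (m + 1)] (s.setVar x 0) with hs1
        obtain ⟨t', ht', h'⟩ := hp s1 hc.2 fun r' hr' => by
          have := hb r' (.inr hr')
          refine ⟨this.1.2, ?_⟩
          rw [hs1, hf, (frame_iterate (r := r) (frame_run p) s _).1 r'
            (by simp [writesVar, this.1])]
          exact this.2
        refine ⟨_, ?_, Exec.loop_true (t := t' + 4) (t' := t) ?_
          (.seq h' (.assign x _ _)) h⟩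
        · simp only [Expr.cost]
          nlinarith
        · simp only [Expr.eval, hs1, hfr, hfx]; omega
    obtain ⟨t, ht, h⟩ := key _ le_rfl
    rw [Nat.sub_self, Function.iterate_zero_apply] at h
    refine ⟨2 + t, ?_, .seq (.assign x (.const 0) s) h⟩
    simp only [time, Polynomial.eval_add, Polynomial.eval_mul, Polynomial.eval_X,
      Polynomial.eval_ofNat]
    have := Nat.mul_le_mul_right (p.time.eval B + 8) hr.2
    omega

end ForProg

/-! ### Half-integral solutions of the linear program -/

section Half

variable {V : Type*} (G : SimpleGraph V)

/-- `C` is a vertex cover of the subgraph induced by `S`. -/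
def Covers (S C : Finset V) : Prop := ∀ u ∈ S, ∀ v ∈ S, G.Adj u v → u ∈ C ∨ v ∈ C

/-- `y / 2` satisfies the constraints of the linear program for the subgraph induced by `S`. -/
def HalfFeasible (S : Finset V) (y : V → ℕ) : Prop :=
  ∀ u ∈ S, ∀ v ∈ S, G.Adj u v → 2 ≤ y u + y v

/-- Twice the minimum value of a half-integral solution for the subgraph induced by `S`. -/
noncomputable def halfOpt (S : Finset V) : ℕ :=
  sInf {m | ∃ y : V → ℕ, HalfFeasible G S y ∧ ∑ v ∈ S, y v = m}

/-- `x` is a feasible solution of the linear program for the subgraph induced by `S`. -/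
def FeasibleOn (S : Finset V) (x : V → ℝ) : Prop :=
  (∀ v ∈ S, 0 ≤ x v) ∧ ∀ u ∈ S, ∀ v ∈ S, G.Adj u v → 1 ≤ x u + x v

/-- `u ↦ f u`, for `u ∈ U`, is a matching of the bipartite double cover of the subgraph induced
by `S`. -/
def IsDoubleMatching (S U : Finset V) (f : V → V) : Prop :=
  U ⊆ S ∧ Set.InjOn f U ∧ ∀ u ∈ U, f u ∈ S ∧ G.Adj u (f u)

variable {G} {S : Finset V}

theorem halfOpt_le {y : V → ℕ} (h : HalfFeasible G S y) : halfOpt G S ≤ ∑ v ∈ S, y v :=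
  Nat.sInf_le ⟨y, h, rfl⟩

variable (G S) in
theorem exists_halfOpt : ∃ y, HalfFeasible G S y ∧ ∑ v ∈ S, y v = halfOpt G S :=
  Nat.sInf_mem (s := {m | ∃ y : V → ℕ, HalfFeasible G S y ∧ ∑ v ∈ S, y v = m})
    ⟨_, fun _ => 2, fun _ _ _ _ _ => by simp, rfl⟩

variable (G S) in
theorem halfOpt_le_card : halfOpt G S ≤ S.card := by
  have : HalfFeasible G S fun _ => 1 := fun _ _ _ _ _ => by simp
  simpa using halfOpt_le this

/-- Weak duality: each matched edge has weight at least 1, and every vertex occurs at most once as a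
left end and at most once as a right end. -/
theorem IsDoubleMatching.card_le [DecidableEq V] {U : Finset V} {f : V → V}
    (h : IsDoubleMatching G S U f) {x : V → ℝ} (hx : FeasibleOn G S x) :
    (U.card : ℝ) ≤ 2 * ∑ v ∈ S, x v := by
  obtain ⟨hU, hf, ha⟩ := h
  have h1 : (U.card : ℝ) ≤ ∑ u ∈ U, (x u + x (f u)) := by
    rw [Finset.card_eq_sum_ones]
    push_cast
    exact Finset.sum_le_sum fun u hu => hx.2 u (hU hu) (f u) (ha u hu).1 (ha u hu).2
  have h2 : ∑ u ∈ U, x u ≤ ∑ v ∈ S, x v :=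
    Finset.sum_le_sum_of_subset_of_nonneg hU fun v hv _ => hx.1 v hv
  have h3 : ∑ u ∈ U, x (f u) ≤ ∑ v ∈ S, x v := by
    rw [← Finset.sum_image (f := x) hf]
    refine Finset.sum_le_sum_of_subset_of_nonneg (fun v hv => ?_) fun v hv _ => hx.1 v hv
    obtain ⟨u, hu, rfl⟩ := Finset.mem_image.1 hv
    exact (ha u hu).1
  rw [Finset.sum_add_distrib] at h1
  linarith

theorem HalfFeasible.feasibleOn {y : V → ℕ} (h : HalfFeasible G S y) :
    FeasibleOn G S fun v => (y v : ℝ) / 2 := by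
  refine ⟨fun v _ => by positivity, fun u hu v hv huv => ?_⟩
  have : (2 : ℝ) ≤ y u + y v := by exact_mod_cast h u hu v hv huv
  linarith

theorem IsDoubleMatching.card_le_halfOpt [DecidableEq V] {U : Finset V} {f : V → V}
    (h : IsDoubleMatching G S U f) : U.card ≤ halfOpt G S := by
  obtain ⟨y, hy, hs⟩ := exists_halfOpt G S
  have := h.card_le hy.feasibleOn
  rw [← Finset.sum_div, mul_div_cancel₀ _ two_ne_zero] at this
  rw [← hs]
  exact_mod_cast this

theorem Covers.halfOpt_le [DecidableEq V] {C : Finset V} (h : Covers G S C) :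
    halfOpt G S ≤ 2 * C.card := by
  have hf : HalfFeasible G S fun v => if v ∈ C then 2 else 0 := by
    intro u hu v hv huv
    rcases h u hu v hv huv with h | h <;> simp [h]
  refine (VCKernel.halfOpt_le hf).trans ?_
  rw [← Finset.sum_filter, Finset.sum_const, smul_eq_mul, mul_comm]
  exact Nat.mul_le_mul_left _ (Finset.card_le_card fun v hv => (Finset.mem_filter.1 hv).2)

theorem Covers.insert [DecidableEq V] {v : V} {C : Finset V} (h : Covers G (S.erase v) C) :
    Covers G S (insert v C) := by
  intro a ha b hb hab
  by_cases h1 : a = v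
  · simp [h1]
  by_cases h2 : b = v
  · simp [h2]
  rcases h a (by simp [ha, h1]) b (by simp [hb, h2]) hab with h | h <;> simp [h]

theorem Covers.erase [DecidableEq V] {C : Finset V} (h : Covers G S C) (v : V) :
    Covers G (S.erase v) (C.erase v) := by
  intro a ha b hb hab
  simp only [Finset.mem_erase] at ha hb ⊢
  rcases h a ha.2 b hb.2 hab with h | h
  exacts [.inl ⟨ha.1, h⟩, .inr ⟨hb.1, h⟩]

end Half

/-! ### Reducible vertices, persistency and uniqueness of the half-integral optimum -/

section Reduction

variable {V : Type*} [DecidableEq V] (G : SimpleGraph V) [DecidableRel G.Adj]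

/-- The neighbours of `v` in `S`. -/
def nbrs (S : Finset V) (v : V) : Finset V := S.filter (G.Adj v)

/-- The members of `S` other than `v` and its neighbours. -/
def delNbrs (S : Finset V) (v : V) : Finset V := S.filter fun w => w ≠ v ∧ ¬ G.Adj v w

/-- Putting the neighbours of `v` into the cover does not increase the value of the linear
program. -/
def Reducible (S : Finset V) (v : V) : Prop :=
  halfOpt G (delNbrs G S v) + 2 * (nbrs G S v).card ≤ halfOpt G S

variable {G} {S : Finset V} {v : V}

theorem sum_eq_delNbrs_add {M : Type*} [AddCommMonoid M] (g : V → M) (hv : v ∈ S) :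
    ∑ w ∈ S, g w = ∑ w ∈ delNbrs G S v, g w + ∑ w ∈ nbrs G S v, g w + g v := by
  rw [← Finset.sum_erase_add S g hv,
    ← Finset.sum_filter_not_add_sum_filter (S.erase v) (G.Adj v)]
  congr 3
  · ext w; simp only [delNbrs, Finset.mem_filter, Finset.mem_erase]; tauto
  · ext w
    simp only [nbrs, Finset.mem_filter, Finset.mem_erase]
    exact ⟨fun h => ⟨h.1.2, h.2⟩, fun h => ⟨⟨h.2.ne', h.1⟩, h.2⟩⟩

theorem card_eq_delNbrs_add (hv : v ∈ S) :
    S.card = (delNbrs G S v).card + (nbrs G S v).card + 1 := by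
  simpa only [Finset.card_eq_sum_ones] using sum_eq_delNbrs_add (G := G) (fun _ => 1) hv

/-- For a reducible vertex this is an optimum solution vanishing at `v`, which is what the
persistency argument starts from. -/
theorem exists_halfFeasible_extend (hv : v ∈ S) :
    ∃ y, HalfFeasible G S y ∧ y v = 0 ∧
      ∑ w ∈ S, y w = halfOpt G (delNbrs G S v) + 2 * (nbrs G S v).card := by
  obtain ⟨y, hy, hs⟩ := exists_halfOpt G (delNbrs G S v)
  refine ⟨fun w => if w = v then 0 else if G.Adj v w then 2 else y w, ?_, by simp, ?_⟩
  · intro a ha b hb hab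
    have hba := hab.symm
    have hne := hab.ne
    by_cases h1 : a = v
    · subst h1; simp [hab, hne.symm]
    by_cases h2 : b = v
    · subst h2; simp [hba, h1]
    by_cases h3 : G.Adj v a
    · simp [h1, h3]
    by_cases h4 : G.Adj v b
    · simp [h2, h4]
    simpa [h1, h2, h3, h4] using hy a (by simp [delNbrs, ha, h1, h3]) b
      (by simp [delNbrs, hb, h2, h4]) hab
  · rw [sum_eq_delNbrs_add (G := G) _ hv, ← hs]
    have e1 : ∑ w ∈ delNbrs G S v, (if w = v then 0 else if G.Adj v w then 2 else y w) =
        ∑ w ∈ delNbrs G S v, y w := Finset.sum_congr rfl fun w hw => by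
      simp only [delNbrs, Finset.mem_filter] at hw
      simp [hw.2]
    have e2 : ∑ w ∈ nbrs G S v, (if w = v then 0 else if G.Adj v w then 2 else y w) =
        ∑ w ∈ nbrs G S v, 2 := Finset.sum_congr rfl fun w hw => by
      simp only [nbrs, Finset.mem_filter] at hw
      simp [hw.2, hw.2.ne']
    rw [e1, e2]
    simp [mul_comm]

theorem halfOpt_le_delNbrs_add (hv : v ∈ S) :
    halfOpt G S ≤ halfOpt G (delNbrs G S v) + 2 * (nbrs G S v).card := by
  obtain ⟨y, hy, -, hs⟩ := exists_halfFeasible_extend (G := G) hv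
  exact hs ▸ halfOpt_le hy

/-- A zero at `v` forces the value 2 on all neighbours, and what remains is feasible for the rest.
Contrapositively, in an irreducible graph every optimum half-integral solution is positive
everywhere. -/
theorem reducible_of_zero {y : V → ℕ} (hy : HalfFeasible G S y)
    (hs : ∑ w ∈ S, y w ≤ halfOpt G S) (hv : v ∈ S) (h0 : y v = 0) : Reducible G S v := by
  have h1 : HalfFeasible G (delNbrs G S v) y := fun a ha b hb =>
    hy a (Finset.mem_filter.1 ha).1 b (Finset.mem_filter.1 hb).1
  have h2 : (nbrs G S v).card * 2 ≤ ∑ w ∈ nbrs G S v, y w := by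
    rw [← smul_eq_mul]
    refine Finset.card_nsmul_le_sum _ _ _ fun w hw => ?_
    have := hy v hv w (Finset.mem_filter.1 hw).1 (Finset.mem_filter.1 hw).2
    omega
  have h3 := halfOpt_le h1
  rw [sum_eq_delNbrs_add (G := G) y hv] at hs
  unfold Reducible
  omega

/-- Otherwise an optimum for `S.erase v`, extended by 2 at `v`, is optimum for `S` and hence has no
zeros. Lowering its value at `v` to 1 keeps it feasible and makes it cheaper. This is what lets the
gap shrink in the branch that takes `v`. -/
theorem halfOpt_lt_erase_add (hirr : ∀ v ∈ S, ¬ Reducible G S v) (hv : v ∈ S) :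
    halfOpt G S < halfOpt G (S.erase v) + 2 := by
  by_contra! hle
  obtain ⟨y, hy, hs⟩ := exists_halfOpt G (S.erase v)
  have hsum (a : ℕ) : ∑ w ∈ S, Function.update y v a w = halfOpt G (S.erase v) + a := by
    rw [← Finset.sum_erase_add S _ hv, Function.update_self, ← hs]
    congr 1
    exact Finset.sum_congr rfl fun w hw => by
      rw [Function.update_of_ne (Finset.ne_of_mem_erase hw)]
  have hf : HalfFeasible G S (Function.update y v 2) := by
    intro a ha b hb hab
    by_cases h1 : a = v
    · subst h1; simp
    by_cases h2 : b = v
    · subst h2; simp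
    simpa [Function.update_apply, h1, h2] using
      hy a (Finset.mem_erase.2 ⟨h1, ha⟩) b (Finset.mem_erase.2 ⟨h2, hb⟩) hab
  have hpos : ∀ w ∈ S, 1 ≤ Function.update y v 2 w := by
    intro w hw
    by_contra! h0
    exact hirr w hw (reducible_of_zero hf (by rw [hsum]; exact hle) hw (by omega))
  have hf1 : HalfFeasible G S (Function.update y v 1) := by
    intro a ha b hb hab
    have h1 := hpos a ha
    have h2 := hpos b hb
    simp only [Function.update_apply] at h1 h2 ⊢
    split_ifs at h1 h2 ⊢ <;> omega
  have := halfOpt_le hf1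
  rw [hsum] at this
  omega

theorem halfOpt_eq_card (hirr : ∀ v ∈ S, ¬ Reducible G S v) : halfOpt G S = S.card := by
  refine (halfOpt_le_card G S).antisymm ?_
  obtain ⟨y, hy, hs⟩ := exists_halfOpt G S
  rw [← hs, Finset.card_eq_sum_ones]
  refine Finset.sum_le_sum fun w hw => ?_
  by_contra! h0
  exact hirr w hw (reducible_of_zero hy hs.le hw (by omega))

/-- A vertex cover that avoids `v` contains the neighbours of `v`. -/
theorem Covers.delNbrs {C : Finset V} (h : Covers G S C) (hv : v ∈ S) (hvC : v ∉ C) :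
    ∃ C', Covers G (VCKernel.delNbrs G S v) C' ∧ C'.card + (nbrs G S v).card ≤ C.card := by
  refine ⟨C \ nbrs G S v, fun a ha b hb hab => ?_, ?_⟩
  · simp only [VCKernel.delNbrs, Finset.mem_filter] at ha hb
    rcases h a ha.1 b hb.1 hab with h | h
    · left; simp [nbrs, h, ha.2]
    · right; simp [nbrs, h, hb.2]
  · rw [Finset.card_sdiff_add_card_eq_card]
    intro w hw
    simp only [nbrs, Finset.mem_filter] at hw
    exact (h v hv w hw.1 hw.2).resolve_left hvC

theorem Covers.union_nbrs {C : Finset V} (h : Covers G (VCKernel.delNbrs G S v) C) :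
    Covers G S (C ∪ nbrs G S v) := by
  intro a ha b hb hab
  simp only [nbrs, Finset.mem_union, Finset.mem_filter]
  by_cases h3 : G.Adj v a
  · exact .inl (.inr ⟨ha, h3⟩)
  by_cases h4 : G.Adj v b
  · exact .inr (.inr ⟨hb, h4⟩)
  have h1 : a ≠ v := fun e => h4 (e ▸ hab)
  have h2 : b ≠ v := fun e => h3 (e ▸ hab.symm)
  rcases h a (by simp [VCKernel.delNbrs, ha, h1, h3]) b
    (by simp [VCKernel.delNbrs, hb, h2, h4]) hab with h | h
  · exact .inl (.inl h)
  · exact .inr (.inl h)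

/-- Persistency: some minimum vertex cover contains the neighbours of a reducible vertex. -/
theorem Reducible.exists_covers (hr : Reducible G S v) (hv : v ∈ S) {C : Finset V}
    (hC : Covers G S C) :
    ∃ C', Covers G (VCKernel.delNbrs G S v) C' ∧ C'.card + (nbrs G S v).card ≤ C.card := by
  obtain ⟨y, hy, hyv, hs⟩ := exists_halfFeasible_extend (G := G) hv
  replace hs : ∑ w ∈ S, y w = halfOpt G S :=
    le_antisymm (hs ▸ hr) (halfOpt_le hy)
  set Z := S.filter (fun w => y w = 0 ∧ w ∈ C) with hZ
  set W := S.filter (fun w => 2 ≤ y w ∧ w ∉ C) with hW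
  -- The exchange: adapt `C` to the optimum `y` by dropping the vertices of value 0 and adding those
  -- of value at least 2. A neighbour of a dropped vertex has value at least 2, so edges stay
  -- covered.
  set C₁ := (C \ S.filter (fun w => y w = 0)) ∪ W with hC₁
  have hcov : Covers G S C₁ := by
    intro a ha b hb hab
    have h1 := hy a ha b hb hab
    have h2 := hC a ha b hb hab
    simp only [hC₁, hW, Finset.mem_union, Finset.mem_sdiff, Finset.mem_filter]
    by_cases h3 : y a = 0
    · by_cases h4 : b ∈ C
      · exact .inr (.inl ⟨h4, fun h => by omega⟩)
      · exact .inr (.inr ⟨hb, by omega, h4⟩)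
    by_cases h5 : y b = 0
    · by_cases h4 : a ∈ C
      · exact .inl (.inl ⟨h4, fun h => by omega⟩)
      · exact .inl (.inr ⟨ha, by omega, h4⟩)
    rcases h2 with h | h
    · exact .inl (.inl ⟨h, fun h => h3 h.2⟩)
    · exact .inr (.inl ⟨h, fun h => h5 h.2⟩)
  -- Raising `y` by 1 on `Z` and lowering it by 1 on `W` stays feasible because `C` is a cover.
  -- Optimality of `y` then gives the inequality.
  have hWZ : W.card ≤ Z.card := by
    set y' : V → ℕ := fun w => if y w = 0 ∧ w ∈ C then y w + 1 else
      if 2 ≤ y w ∧ w ∉ C then y w - 1 else y w with hy'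
    have hf : HalfFeasible G S y' := by
      intro a ha b hb hab
      have h1 := hy a ha b hb hab
      have h2 := hC a ha b hb hab
      simp only [hy']
      by_cases h3 : a ∈ C <;> by_cases h4 : b ∈ C <;> simp [h3, h4] at h2 ⊢ <;>
        split_ifs <;> omega
    have hsum : ∑ w ∈ S, y' w + W.card = ∑ w ∈ S, y w + Z.card := by
      rw [hW, hZ, Finset.card_filter, Finset.card_filter, ← Finset.sum_add_distrib,
        ← Finset.sum_add_distrib]
      refine Finset.sum_congr rfl fun w _ => ?_
      simp only [hy']
      split_ifs <;> omega
    have := halfOpt_le hf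
    omega
  have hvC₁ : v ∉ C₁ := by
    simp [hC₁, hW, hyv, hv]
  obtain ⟨C', h1, h2⟩ := hcov.delNbrs hv hvC₁
  refine ⟨C', h1, h2.trans ?_⟩
  have h3 : C \ S.filter (fun w => y w = 0) = C \ Z := by
    ext w; simp [hZ]; tauto
  have h4 : (C \ Z).card + Z.card = C.card :=
    Finset.card_sdiff_add_card_eq_card fun w hw => (Finset.mem_filter.1 hw).2.2
  have := Finset.card_union_le (C \ Z) W
  rw [hC₁, h3]
  omega

/-- If no vertex is reducible then the all-`1/2` vector is the only optimum solution. -/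
theorem eq_half_of_irreducible (hirr : ∀ v ∈ S, ¬ Reducible G S v) {U : Finset V} {f : V → V}
    (hm : IsDoubleMatching G S U f) (hU : U.card = halfOpt G S) {x : V → ℝ}
    (hx : FeasibleOn G S x) (hs : 2 * ∑ w ∈ S, x w ≤ S.card) : ∀ w ∈ S, x w = 1 / 2 := by
  rw [halfOpt_eq_card hirr] at hU
  -- The matching is perfect, so `f` permutes `S`.
  have hUS : U = S := Finset.eq_of_subset_of_card_le hm.1 hU.ge
  subst hUS
  obtain ⟨-, hf, ha⟩ := hm
  have himg : U.image f = U := Finset.eq_of_subset_of_card_le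
    (fun w hw => by obtain ⟨u, hu, rfl⟩ := Finset.mem_image.1 hw; exact (ha u hu).1)
    (Finset.card_image_of_injOn hf).ge
  have hsum (g : V → ℝ) : ∑ w ∈ U, g (f w) = ∑ w ∈ U, g w := by
    rw [← Finset.sum_image (f := g) hf, himg]
  -- Equality in weak duality makes every matched edge tight.
  have htight : ∀ w ∈ U, x w + x (f w) = 1 := by
    have h1 : ∑ w ∈ U, (1 : ℝ) = ∑ w ∈ U, (x w + x (f w)) := by
      refine le_antisymm (Finset.sum_le_sum fun w hw => hx.2 w hw _ (ha w hw).1 (ha w hw).2) ?_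
      rw [Finset.sum_add_distrib, hsum]
      simp only [Finset.sum_const, nsmul_eq_mul, mul_one]
      linarith
    have h2 := (Finset.sum_eq_sum_iff_of_le fun w hw =>
      hx.2 w hw _ (ha w hw).1 (ha w hw).2).1 h1
    exact fun w hw => (h2 w hw).symm
  -- Rounding at 1/2 preserves feasibility, and on tight edges the two rounded values sum to 2, so
  -- `y` is optimum. Irreducibility forbids zeros of `y`, whence `x` is at least 1/2, and tightness
  -- forces equality.
  set y : V → ℕ := fun w => if x w < 1 / 2 then 0 else if 1 / 2 < x w then 2 else 1 with hy
  have hyf : HalfFeasible G U y := by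
    intro a ha b hb hab
    have h1 := hx.2 a ha b hb hab
    simp only [hy]
    split_ifs <;> first | omega | (exfalso; linarith)
  have hysum : ∑ w ∈ U, y w = U.card := by
    have h1 : ∀ w ∈ U, (y w : ℝ) + y (f w) = 2 := by
      intro w hw
      have h1 := htight w hw
      simp only [hy]
      split_ifs <;> first | (exfalso; linarith) | norm_num
    have h2 : ∑ w ∈ U, ((y w : ℝ) + y (f w)) = ∑ w ∈ U, (2 : ℝ) := Finset.sum_congr rfl h1
    rw [Finset.sum_add_distrib, hsum fun w => (y w : ℝ)] at h2
    simp only [Finset.sum_const, nsmul_eq_mul] at h2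
    have : ∑ w ∈ U, (y w : ℝ) = U.card := by linarith
    exact_mod_cast this
  have hge : ∀ w ∈ U, 1 / 2 ≤ x w := by
    intro w hw
    by_contra! h
    exact hirr w hw (reducible_of_zero hyf (by rw [hysum, halfOpt_eq_card hirr]) hw
      (by simp only [hy, h, if_true]))
  intro w hw
  linarith [hge w hw, hge _ (ha w hw).1, htight w hw]

end Reduction

/-! ### Induced subgraphs as graphs of their own -/

section Comap

variable {V W : Type*} [Fintype W] {G : SimpleGraph V} {e : W ↪ V}
  {U : Finset V} {f : V → V}

theorem sum_map_extend (x : W → ℝ) :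
    ∑ v ∈ Finset.univ.map e, Function.extend e x 0 v = ∑ w, x w := by
  simp [Finset.sum_map, e.injective.extend_apply]

theorem feasibleOn_extend {x : W → ℝ} (h : LPFeasible (G.comap e) x) :
    FeasibleOn G (Finset.univ.map e) (Function.extend e x 0) := by
  constructor
  · intro v hv
    obtain ⟨w, -, rfl⟩ := Finset.mem_map.1 hv
    simpa [e.injective.extend_apply] using h.1 w
  · intro u hu v hv huv
    obtain ⟨a, -, rfl⟩ := Finset.mem_map.1 hu
    obtain ⟨b, -, rfl⟩ := Finset.mem_map.1 hv
    simpa [e.injective.extend_apply] using h.2 a b huv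

/-- The minimum over real solutions is attained by a half-integral one, since the matching certifies
the lower bound. -/
theorem vcStar_comap [DecidableEq V] (hm : IsDoubleMatching G (Finset.univ.map e) U f)
    (hU : U.card = halfOpt G (Finset.univ.map e)) :
    vcStar (G.comap e) = (halfOpt G (Finset.univ.map e) : ℝ) / 2 := by
  refine IsLeast.csInf_eq ⟨?_, ?_⟩
  · obtain ⟨y, hy, hs⟩ := exists_halfOpt G (Finset.univ.map e)
    refine ⟨fun w => (y (e w) : ℝ) / 2, ⟨fun w => by positivity, fun a b hab => ?_⟩, ?_⟩
    · exact hy.feasibleOn.2 (e a) (by simp) (e b) (by simp) hab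
    · rw [← hs, Finset.sum_map, ← Finset.sum_div]
      push_cast
      rfl
  · rintro _ ⟨x, hx, rfl⟩
    have := hm.card_le (feasibleOn_extend hx)
    rw [sum_map_extend, hU] at this
    linarith

theorem uniqueHalf_comap [DecidableEq V] [DecidableRel G.Adj]
    (hirr : ∀ v ∈ Finset.univ.map e, ¬ Reducible G (Finset.univ.map e) v)
    (hm : IsDoubleMatching G (Finset.univ.map e) U f)
    (hU : U.card = halfOpt G (Finset.univ.map e)) : UniqueHalf (G.comap e) := by
  have hhalf : LPFeasible (G.comap e) fun _ => 1 / 2 :=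
    ⟨fun _ => by norm_num, fun _ _ _ => by norm_num⟩
  have hcard := halfOpt_eq_card hirr
  intro x
  constructor
  · rintro ⟨hx, hopt⟩
    have h1 := hopt _ hhalf
    have h2 := eq_half_of_irreducible hirr hm hU (feasibleOn_extend hx) (by
      rw [sum_map_extend]
      simp only [Finset.sum_const, nsmul_eq_mul] at h1
      simp only [Finset.card_map]
      linarith)
    funext w
    simpa [e.injective.extend_apply] using h2 (e w) (by simp)
  · rintro rfl
    refine ⟨hhalf, fun x hx => ?_⟩
    have := hm.card_le (feasibleOn_extend hx)
    rw [sum_map_extend, hU, hcard, Finset.card_map] at this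
    simp only [Finset.sum_const, nsmul_eq_mul]
    linarith

theorem isVertexCover_comap_iff {k : ℕ} :
    (∃ C : Finset W, (G.comap e).IsVertexCover (C : Set W) ∧ C.card ≤ k) ↔
      ∃ C, Covers G (Finset.univ.map e) C ∧ C.card ≤ k := by
  constructor
  · rintro ⟨C, hC, hk⟩
    refine ⟨C.map e, fun u hu v hv huv => ?_, by simpa using hk⟩
    obtain ⟨a, -, rfl⟩ := Finset.mem_map.1 hu
    obtain ⟨b, -, rfl⟩ := Finset.mem_map.1 hv
    simpa using hC (v := a) (w := b) huv
  · rintro ⟨C, hC, hk⟩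
    refine ⟨C.preimage e e.injective.injOn, fun a b hab => ?_, ?_⟩
    · simpa using hC (e a) (by simp) (e b) (by simp) hab
    · refine le_trans ?_ hk
      rw [← Finset.card_map e]
      exact Finset.card_le_card fun v hv => by
        obtain ⟨w, hw, rfl⟩ := Finset.mem_map.1 hv
        simpa using hw

end Comap

/-! ### Computing the value of the linear program by an auction -/

section Auction

variable {G : SimpleGraph ℕ} {S : Finset ℕ} {n : ℕ} {mate price : ℕ → ℕ}

variable (G S n) in
/-- The invariant of the auction: the left copy of `u` holds the right copy of `v` if
`mate u = v + 1`; it has paid at most one more than the cheapest of its neighbours costs. -/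
structure AuctionInv (mate price : ℕ → ℕ) : Prop where
  mate_spec : ∀ u < n, ∀ v, mate u = v + 1 →
    u ∈ S ∧ v ∈ S ∧ G.Adj u v ∧ ∀ w ∈ S, G.Adj u w → price v ≤ price w + 1
  inj : ∀ u < n, ∀ v < n, mate u = mate v → mate u ≠ 0 → u = v
  owned : ∀ v ∈ S, price v ≠ 0 → ∃ u ∈ S, mate u = v + 1
  price_le : ∀ v ∈ S, price v ≤ n

variable (G S) in
/-- The left copy of `u` does not hold anything and may bid for the right copy of `v`. -/
def Bid (mate : ℕ → ℕ) (u v : ℕ) : Prop := mate u = 0 ∧ u ∈ S ∧ v ∈ S ∧ G.Adj u v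

/-- The winner `a` holds a cheapest neighbour, now one dearer than when it was chosen, which is
exactly the slack of 1 in the invariant. Any previous holder of `b` is released. For everyone else
prices of competing neighbours only rise. -/
theorem AuctionInv.bid (h : AuctionInv G S n mate price) (hS : ∀ u ∈ S, u < n) {a b : ℕ}
    (hab : Bid G S mate a b) (hb : price b < n)
    (hmin : ∀ u v, Bid G S mate u v → price b ≤ price v) {mate' : ℕ → ℕ}
    (hm : ∀ u < n, mate' u = if u = a then b + 1 else if mate u = b + 1 then 0 else mate u) :
    AuctionInv G S n mate' (Function.update price b (price b + 1)) := by
  obtain ⟨h0, ha, hbS, hadj⟩ := hab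
  have hle (w : ℕ) : price w ≤ Function.update price b (price b + 1) w := by
    rw [Function.update_apply]; split_ifs with h
    · subst h; omega
    · exact le_rfl
  refine ⟨fun u hu v huv => ?_, fun u hu v hv huv hne => ?_, fun v hv hp => ?_, fun v hv => ?_⟩
  · rw [hm u hu] at huv
    split_ifs at huv with h1 h2
    · obtain rfl : b = v := by omega
      subst h1
      refine ⟨ha, hbS, hadj, fun w hw huw => ?_⟩
      rw [Function.update_self]
      have := hmin u w ⟨h0, ha, hw, huw⟩
      have := hle w
      omega
    · obtain ⟨h3, h4, h5, h6⟩ := h.mate_spec u hu v huv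
      refine ⟨h3, h4, h5, fun w hw huw => ?_⟩
      rw [Function.update_of_ne (by omega)]
      exact (h6 w hw huw).trans (by have := hle w; omega)
  · rw [hm u hu] at huv hne
    rw [hm v hv] at huv
    by_cases h1 : u = a <;> by_cases h2 : v = a <;> simp only [h1, h2, if_true, if_false] at *
    · split_ifs at huv
      omega
    · split_ifs at huv
      omega
    · have h3 : mate u ≠ b + 1 := fun h => by simp [h] at hne
      simp only [h3, if_false] at huv hne
      split_ifs at huv with h4
      · exact absurd huv hne
      · exact h.inj u hu v hv huv hne
  · by_cases h1 : v = b
    · subst h1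
      exact ⟨a, ha, by simp [hm a (hS a ha)]⟩
    · rw [Function.update_of_ne h1] at hp
      obtain ⟨u, hu, huv⟩ := h.owned v hv hp
      refine ⟨u, hu, ?_⟩
      have h2 : u ≠ a := fun e => by subst e; omega
      simp [hm u (hS u hu), h2, huv, h1]
  · rw [Function.update_apply]
    split_ifs
    · omega
    · exact h.price_le v hv

/-- When nobody can bid any more, the matching is as large as twice the minimum value of the
linear program. -/
theorem AuctionInv.final (h : AuctionInv G S n mate price) (hS : ∀ u ∈ S, u < n)
    (hdone : ∀ u v, Bid G S mate u v → n ≤ price v) :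
    IsDoubleMatching G S ((Finset.range n).filter fun u => mate u ≠ 0) (fun u => mate u - 1) ∧
      ((Finset.range n).filter fun u => mate u ≠ 0).card = halfOpt G S := by
  have hm : IsDoubleMatching G S ((Finset.range n).filter fun u => mate u ≠ 0)
      (fun u => mate u - 1) := by
    refine ⟨fun u hu => ?_, fun u hu v hv huv => ?_, fun u hu => ?_⟩
    · simp only [Finset.mem_filter, Finset.mem_range] at hu
      exact (h.mate_spec u hu.1 (mate u - 1) (by omega)).1
    · simp only [Finset.coe_filter, Finset.mem_range, Set.mem_ofPred_eq] at hu hv huv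
      exact h.inj u hu.1 v hv.1 (by omega) hu.2
    · simp only [Finset.mem_filter, Finset.mem_range] at hu
      have := h.mate_spec u hu.1 (mate u - 1) (by omega)
      exact ⟨this.2.1, this.2.2.1⟩
  refine ⟨hm, le_antisymm hm.card_le_halfOpt ?_⟩
  -- Pigeonhole: there are `n + 1` levels and at most `n` vertices.
  obtain ⟨l, hl, hgap⟩ : ∃ l ≤ n, ∀ v ∈ S, price v ≠ l := by
    have hcard : (S.image price).card < (Finset.range (n + 1)).card := by
      refine Finset.card_image_le.trans_lt ?_
      rw [Finset.card_range]
      have := Finset.card_le_card (fun u hu => Finset.mem_range.2 (hS u hu) : S ⊆ Finset.range n)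
      rw [Finset.card_range] at this
      omega
    obtain ⟨l, hl, hl'⟩ := Finset.exists_mem_notMem_of_card_lt_card hcard
    refine ⟨l, by simpa [Nat.lt_succ_iff] using hl, fun v hv e => hl' ?_⟩
    exact Finset.mem_image.2 ⟨v, hv, e⟩
  set A : ℕ → Prop := fun u => mate u = 0 ∨ l < price (mate u - 1) with hA
  -- A left copy in `A` sees only prices at least `l`: its neighbours cost at least `n` if it is
  -- free, and at most one less than its own holding otherwise. Since no price equals `l`, they
  -- exceed `l`.
  have hnbr : ∀ u ∈ S, A u → ∀ w ∈ S, G.Adj u w → l < price w := by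
    intro u hu hAu w hw huw
    refine lt_of_le_of_ne ?_ (hgap w hw).symm
    by_cases h0 : mate u = 0
    · exact hl.trans (hdone u w ⟨h0, hu, hw, huw⟩)
    · have h1 := hAu.resolve_left h0
      have h2 := (h.mate_spec u (hS u hu) (mate u - 1) (by omega)).2.2.2 w hw huw
      omega
  classical
  -- A vertex cover of the double cover, folded back to `S`: the left copies outside `A` and the
  -- right copies dearer than `l`. Each of the latter is owned by a matched member of `A`, so the
  -- cover is no larger than the matching.
  set y : ℕ → ℕ := fun w => (if A w then 0 else 1) + (if l < price w then 1 else 0) with hy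
  have hf : HalfFeasible G S y := by
    intro u hu w hw huw
    have h1 := fun hAu => hnbr u hu hAu w hw huw
    have h2 := fun hAw => hnbr w hw hAw u hu huw.symm
    simp only [hy]
    split_ifs <;> omega
  refine (halfOpt_le hf).trans ?_
  have h1 : ∑ w ∈ S, y w = (S.filter fun w => ¬ A w).card +
      (S.filter fun w => l < price w).card := by
    rw [Finset.sum_add_distrib, Finset.card_filter, Finset.card_filter]
    congr 1
    exact Finset.sum_congr rfl fun w _ => by split_ifs <;> rfl
  have h2 : (S.filter fun w => l < price w).card ≤
      (S.filter fun u => mate u ≠ 0 ∧ A u).card := by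
    refine Finset.card_le_card_of_surjOn (fun u => mate u - 1) fun w hw => ?_
    simp only [Finset.coe_filter, Set.mem_ofPred_eq] at hw
    obtain ⟨u, hu, huw⟩ := h.owned w hw.1 (by omega)
    refine ⟨u, ?_, by simp [huw]⟩
    simp [hA, hu, huw, hw.2]
  have h3 : (S.filter fun w => ¬ A w).card + (S.filter fun u => mate u ≠ 0 ∧ A u).card =
      (S.filter fun u => mate u ≠ 0).card := by
    rw [← Finset.card_filter_add_card_filter_not (s := S.filter fun u => mate u ≠ 0) A,
      Finset.filter_filter, Finset.filter_filter, add_comm]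
    congr 2
    refine Finset.filter_congr fun u _ => ?_
    simp only [hA]; tauto
  have h4 : (S.filter fun u => mate u ≠ 0).card ≤
      ((Finset.range n).filter fun u => mate u ≠ 0).card :=
    Finset.card_le_card fun u hu => by
      simp only [Finset.mem_filter, Finset.mem_range] at hu ⊢
      exact ⟨hS u hu.1, hu.2⟩
  omega

end Auction

/-! ### The auction as a program -/

open ForProg

/-- The contents of the cell of array `a` that is addressed by register `x`. -/
def cell (a x : ℕ) : Expr := .get a (.var x)

/-- The entry of the adjacency matrix in the row and the column given by the registers `x`
and `y`; array 1 holds the addresses of the rows. -/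
def adjEntry (x y : ℕ) : Expr := .get 0 (.add (.get 1 (.var x)) (.var y))

/-- The memory `s` holds the graph `G` on the vertices `0, …, n - 1`. -/
structure HoldsGraph (G : SimpleGraph ℕ) (n : ℕ) (s : State) : Prop where
  order : s.var 0 = n
  rounds : s.var 2 = n * n + 1
  row : ∀ i < n, s.arr 1 i = i * n
  adj : ∀ i < n, ∀ j < n, s.arr 0 (i * n + j) ≠ 0 ↔ G.Adj i j

theorem HoldsGraph.congr {G : SimpleGraph ℕ} {n : ℕ} {s s' : State} (h : HoldsGraph G n s)
    (h0 : s'.var 0 = s.var 0) (h2 : s'.var 2 = s.var 2) (ha : s'.arr 0 = s.arr 0)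
    (hb : s'.arr 1 = s.arr 1) : HoldsGraph G n s' :=
  ⟨h0 ▸ h.order, h2 ▸ h.rounds, hb ▸ h.row, ha ▸ h.adj⟩

theorem HoldsGraph.frame {G : SimpleGraph ℕ} {n : ℕ} {s s' : State} {p : ForProg}
    (h : HoldsGraph G n s) (hf : p.Frame s s')
    (hp : (p.writesVar 0 || p.writesVar 2 || p.writesArr 0 || p.writesArr 1) = false) :
    HoldsGraph G n s' := by
  simp only [Bool.or_eq_false_iff] at hp
  exact h.congr (hf.1 _ hp.1.1.1) (hf.1 _ hp.1.1.2) (hf.2 _ hp.1.2) (hf.2 _ hp.2)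

/-- Array `a` holds the set `S` of vertices. -/
def HoldsSet (S : Finset ℕ) (n a : ℕ) (s : State) : Prop :=
  ∀ w < n, s.arr a w = if w ∈ S then 1 else 0

/-- Record the bid given by the registers 4 and 5. -/
def recordBid : ForProg :=
  .seq (.assign 6 (cell 5 5)) (.seq (.assign 7 (.var 4)) (.assign 8 (.var 5)))

/-- Compare the cheapest bid so far with the bid given by the registers 4 and 5. -/
def compareBid : ForProg :=
  .ite (cell 3 5) (.ite (adjEntry 4 5) (.ite (.sub (.var 6) (cell 5 5)) recordBid .skip) .skip)
    .skip

/-- Search for the cheapest possible bid. -/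
def auctionScan : ForProg :=
  .forLoop 0 4 (.ite (cell 4 4) .skip (.ite (cell 3 4) (.forLoop 0 5 compareBid) .skip))

/-- Free the vertex that holds the right copy of the vertex in register 8. -/
def evict : ForProg :=
  .forLoop 0 9 (.ite (.add (.sub (cell 4 9) (.add (.var 8) (.const 1)))
    (.sub (.add (.var 8) (.const 1)) (cell 4 9))) .skip (.store 4 (.var 9) (.const 0)))

/-- Let the bid in the registers 7 and 8 succeed. -/
def placeBid : ForProg :=
  .seq evict (.seq (.store 4 (.var 7) (.add (.var 8) (.const 1)))
    (.store 5 (.var 8) (.add (cell 5 8) (.const 1))))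

/-- One bid. -/
def auctionStep : ForProg :=
  .seq (.assign 6 (.var 0)) (.seq auctionScan (.ite (.sub (.var 0) (.var 6)) placeBid .skip))

/-- Nobody holds anything, and everything is free. -/
def auctionInit : ForProg :=
  .forLoop 0 4 (.seq (.store 4 (.var 4) (.const 0)) (.store 5 (.var 4) (.const 0)))

/-- Count the vertices that hold something. -/
def auctionCount : ForProg :=
  .seq (.assign 10 (.const 0))
    (.forLoop 0 4 (.ite (cell 4 4) (.assign 10 (.add (.var 10) (.const 1))) .skip))

/-- The program that computes the value of the linear program for the subgraph induced by the
set in array 3. -/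
def auction : ForProg :=
  .seq auctionInit (.seq (.forLoop 2 3 auctionStep) auctionCount)

section

variable {G : SimpleGraph ℕ} {S : Finset ℕ} {n : ℕ} {s : State}

/-- The registers 6, 7, 8 hold the cheapest of the bids in `P`. -/
def Cheapest (G : SimpleGraph ℕ) (S : Finset ℕ) (n : ℕ) (mate price : ℕ → ℕ)
    (P : ℕ → ℕ → Prop) (s : State) : Prop :=
  s.var 6 ≤ n ∧ (∀ u v, P u v → Bid G S mate u v → s.var 6 ≤ price v) ∧
    (s.var 6 < n → Bid G S mate (s.var 7) (s.var 8) ∧ price (s.var 8) = s.var 6)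

theorem run_compareBid {m p : ℕ → ℕ} {i j : ℕ} (hG : HoldsGraph G n s) (hW : HoldsSet S n 3 s)
    (hp : s.arr 5 = p) (hi : i < n) (hj : j < n) (hiS : i ∈ S)
    (h0 : m i = 0) (h4 : s.var 4 = i) (h5 : s.var 5 = j)
    (h : Cheapest G S n m p (fun u v => u < i ∨ u = i ∧ v < j) s) :
    Cheapest G S n m p (fun u v => u < i ∨ u = i ∧ v < j + 1) (compareBid.run s) := by
  have hext {s' : State} (hs : Cheapest G S n m p (fun u v => u < i ∨ u = i ∧ v < j) s')
      (hno : Bid G S m i j → s'.var 6 ≤ p j) :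
      Cheapest G S n m p (fun u v => u < i ∨ u = i ∧ v < j + 1) s' := by
    refine ⟨hs.1, fun u v huv hb => ?_, hs.2.2⟩
    by_cases he : u = i ∧ v = j
    · rw [he.2]; exact hno (by rw [he.1, he.2] at hb; exact hb)
    · exact hs.2.1 u v (by omega) hb
  rw [compareBid]
  by_cases h1 : j ∈ S
  swap
  · rw [run_ite_neg (by simp [cell, Expr.eval, h5, hW j hj, h1])]
    exact hext h fun hb => absurd hb.2.2.1 h1
  rw [run_ite_pos (by simp [cell, Expr.eval, h5, hW j hj, h1])]
  have hadj : (adjEntry 4 5).eval s ≠ 0 ↔ G.Adj i j := by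
    simpa only [adjEntry, Expr.eval, h4, h5, hG.row i hi] using hG.adj i hi j hj
  by_cases h2 : G.Adj i j
  swap
  · rw [run_ite_neg (not_not.1 (mt hadj.1 h2))]
    exact hext h fun hb => absurd hb.2.2.2 h2
  rw [run_ite_pos (hadj.2 h2)]
  by_cases h3 : p j < s.var 6
  swap
  · rw [run_ite_neg (by simp only [cell, Expr.eval, h5, hp]; omega)]
    exact hext h fun _ => not_lt.1 h3
  rw [run_ite_pos (by simp only [cell, Expr.eval, h5, hp]; omega)]
  have e6 : (recordBid.run s).var 6 = p j := by simp [recordBid, ForProg.run, cell, Expr.eval, h5, hp]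
  have e7 : (recordBid.run s).var 7 = i := by simp [recordBid, ForProg.run, cell, Expr.eval, h4]
  have e8 : (recordBid.run s).var 8 = j := by simp [recordBid, ForProg.run, cell, Expr.eval, h5]
  have := h.1
  refine ⟨by omega, fun u v huv hb => ?_, fun _ => ?_⟩
  · by_cases he : u = i ∧ v = j
    · rw [e6, he.2]
    · have := h.2.1 u v (by omega) hb
      omega
  · rw [e6, e7, e8]
    exact ⟨⟨h0, hiS, h1, h2⟩, rfl⟩

/-- Register 6 starts at the sentinel `n`, so bids at price `n` or more are never recorded, and the
value `n` at the end means that there is no affordable bid. -/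
theorem run_auctionScan (hG : HoldsGraph G n s) (hS : ∀ u ∈ S, u < n) (hW : HoldsSet S n 3 s)
    (h6 : s.var 6 = n) :
    Cheapest G S n (s.arr 4) (s.arr 5) (fun _ _ => True) (auctionScan.run s) := by
  have key := run_forLoop (r := 0) (x := 4) (s := s)
    (p := .ite (cell 4 4) .skip (.ite (cell 3 4) (.forLoop 0 5 compareBid) .skip)) rfl
    (fun i s' => Cheapest G S n (s.arr 4) (s.arr 5) (fun u _ => u < i) s') ?_ ?_
  · obtain ⟨h1, h2, h3⟩ := key
    refine ⟨h1, fun u v _ h => h2 u v ?_ h, h3⟩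
    rw [hG.order]
    exact hS u h.2.1
  · simp [Cheapest, h6]
  · intro i s' hi hx hf hI
    rw [hG.order] at hi
    have hG' := hG.frame hf rfl
    have e3 : s'.arr 3 = s.arr 3 := hf.2 3 rfl
    have e4 : s'.arr 4 = s.arr 4 := hf.2 4 rfl
    have e5 : s'.arr 5 = s.arr 5 := hf.2 5 rfl
    have hext (hno : ∀ v, ¬ Bid G S (s.arr 4) i v) :
        Cheapest G S n (s.arr 4) (s.arr 5) (fun u _ => u < i + 1) (s'.setVar 4 (i + 1)) := by
      refine ⟨hI.1, fun u v hu hb => hI.2.1 u v ?_ hb, hI.2.2⟩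
      have : u ≠ i := fun e => hno v (e ▸ hb)
      omega
    by_cases h1 : s.arr 4 i = 0
    swap
    · rw [run_ite_pos (by simpa [cell, Expr.eval, hx, e4] using h1)]
      exact hext fun v hb => h1 hb.1
    rw [run_ite_neg (by simpa [cell, Expr.eval, hx, e4] using h1)]
    by_cases hiS : i ∈ S
    swap
    · rw [run_ite_neg (by simp [cell, Expr.eval, hx, e3, hW i hi, hiS])]
      exact hext fun v hb => hiS hb.2.1
    rw [run_ite_pos (by simp [cell, Expr.eval, hx, e3, hW i hi, hiS])]
    have inner := run_forLoop (r := 0) (x := 5) (s := s') (p := compareBid) rfl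
      (fun j s'' => Cheapest G S n (s.arr 4) (s.arr 5)
        (fun u v => u < i ∨ u = i ∧ v < j) s'') ?_ ?_
    · refine ⟨inner.1, fun u v hu hb => inner.2.1 u v ?_ hb, inner.2.2⟩
      have := hS v hb.2.2.1
      rw [hG'.order]
      omega
    · refine ⟨hI.1, fun u v hu hb => hI.2.1 u v (by omega) hb, hI.2.2⟩
    · intro j s'' hj hx' hf' hI'
      rw [hG'.order] at hj
      exact run_compareBid (hG'.frame hf' rfl)
        (by unfold HoldsSet; rw [hf'.2 3 rfl, e3]; exact hW)
        ((hf'.2 5 rfl).trans e5) hi hj hiS h1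
        ((hf'.1 4 rfl).trans hx) hx' hI'

/-- The sum of the two opposite truncated differences vanishes exactly when the numbers agree, so
the store is in the else branch. -/
theorem run_evict (h0 : s.var 0 = n) :
    ∀ u < n, (evict.run s).arr 4 u = if s.arr 4 u = s.var 8 + 1 then 0 else s.arr 4 u := by
  have key := run_forLoop (r := 0) (x := 9) (s := s)
    (p := .ite (.add (.sub (cell 4 9) (.add (.var 8) (.const 1)))
        (.sub (.add (.var 8) (.const 1)) (cell 4 9))) .skip (.store 4 (.var 9) (.const 0))) rfl
    (fun i s' => (∀ u < i, s'.arr 4 u = if s.arr 4 u = s.var 8 + 1 then 0 else s.arr 4 u) ∧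
      ∀ u ≥ i, s'.arr 4 u = s.arr 4 u) ?_ ?_
  · rw [h0] at key
    exact key.1
  · simp
  · intro i s' hi hx hf ⟨hI, hI'⟩
    have e8 : s'.var 8 = s.var 8 := hf.1 8 rfl
    have e4 := hI' i le_rfl
    by_cases h : s.arr 4 i = s.var 8 + 1
    · rw [run_ite_neg (by simp only [cell, Expr.eval, hx, e8, e4]; omega)]
      refine ⟨fun u hu => ?_, fun u hu => ?_⟩
      · simp only [ForProg.run, Expr.eval, hx, State.arr_setVar, State.arr_setArr, if_true,
          Function.update_apply]
        rcases Nat.lt_succ_iff_lt_or_eq.1 hu with hu | rfl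
        · rw [if_neg (by omega)]
          exact hI u hu
        · rw [if_pos rfl, if_pos h]
      · simp only [ForProg.run, Expr.eval, hx, State.arr_setVar, State.arr_setArr, if_true,
          Function.update_apply]
        rw [if_neg (by omega)]
        exact hI' u (by omega)
    · rw [run_ite_pos (by simp only [cell, Expr.eval, hx, e8, e4]; omega)]
      refine ⟨fun u hu => ?_, fun u hu => hI' u (by omega)⟩
      rcases Nat.lt_succ_iff_lt_or_eq.1 hu with hu | rfl
      · exact hI u hu
      · rw [if_neg h]
        exact e4

theorem run_placeBid (hG : HoldsGraph G n s) (hS : ∀ u ∈ S, u < n)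
    (hA : AuctionInv G S n (s.arr 4) (s.arr 5)) (hb : Bid G S (s.arr 4) (s.var 7) (s.var 8))
    (hlt : s.arr 5 (s.var 8) < n)
    (hmin : ∀ u v, Bid G S (s.arr 4) u v → s.arr 5 (s.var 8) ≤ s.arr 5 v) :
    AuctionInv G S n ((placeBid.run s).arr 4) ((placeBid.run s).arr 5) ∧
      ∑ v ∈ S, s.arr 5 v < ∑ v ∈ S, (placeBid.run s).arr 5 v := by
  have hev := run_evict hG.order
  have hf := frame_run evict s
  have e7 : (evict.run s).var 7 = s.var 7 := hf.1 7 rfl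
  have e8 : (evict.run s).var 8 = s.var 8 := hf.1 8 rfl
  have e5 : (evict.run s).arr 5 = s.arr 5 := hf.2 5 rfl
  have h4 : (placeBid.run s).arr 4 =
      Function.update ((evict.run s).arr 4) (s.var 7) (s.var 8 + 1) := by
    simp [placeBid, ForProg.run, Expr.eval, e7, e8]
  have h5 : (placeBid.run s).arr 5 =
      Function.update (s.arr 5) (s.var 8) (s.arr 5 (s.var 8) + 1) := by
    simp [placeBid, ForProg.run, cell, Expr.eval, e5, e8]
  rw [h4, h5]
  refine ⟨hA.bid hS hb hlt hmin fun u hu => ?_, ?_⟩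
  · rw [Function.update_apply, hev u hu]
  · refine Finset.sum_lt_sum (fun v _ => ?_) ⟨s.var 8, hb.2.2.1, by simp⟩
    rw [Function.update_apply]
    split_ifs with hv
    · subst hv; omega
    · exact le_rfl

/-- A round of the auction. -/
theorem run_auctionStep (hG : HoldsGraph G n s) (hS : ∀ u ∈ S, u < n) (hW : HoldsSet S n 3 s)
    (hA : AuctionInv G S n (s.arr 4) (s.arr 5)) :
    AuctionInv G S n ((auctionStep.run s).arr 4) ((auctionStep.run s).arr 5) ∧
      (((∃ u v, Bid G S (s.arr 4) u v ∧ s.arr 5 v < n) ∧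
          ∑ v ∈ S, s.arr 5 v < ∑ v ∈ S, (auctionStep.run s).arr 5 v) ∨
        ∀ u v, Bid G S ((auctionStep.run s).arr 4) u v → n ≤ (auctionStep.run s).arr 5 v) := by
  have hc : Cheapest G S n (s.arr 4) (s.arr 5) (fun _ _ => True)
      (auctionScan.run (s.setVar 6 (s.var 0))) :=
    run_auctionScan (s := s.setVar 6 (s.var 0)) (hG.congr rfl rfl rfl rfl) hS hW
      (by simp [hG.order])
  have hf := frame_run auctionScan (s.setVar 6 (s.var 0))
  have hstep : auctionStep.run s = (ForProg.ite (.sub (.var 0) (.var 6)) placeBid .skip).run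
    (auctionScan.run (s.setVar 6 (s.var 0))) := rfl
  rw [hstep]
  set s1 := auctionScan.run (s.setVar 6 (s.var 0)) with hs1
  have hG1 : HoldsGraph G n s1 := (hG.congr rfl rfl rfl rfl : HoldsGraph G n (s.setVar 6 _)).frame
    hf rfl
  have e0 : s1.var 0 = n := hG1.order
  have e4 : s1.arr 4 = s.arr 4 := hf.2 4 rfl
  have e5 : s1.arr 5 = s.arr 5 := hf.2 5 rfl
  obtain ⟨h1, h2, h3⟩ := hc
  by_cases h : s1.var 6 < n
  · rw [run_ite_pos (by simp only [Expr.eval]; omega)]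
    obtain ⟨h4, h5⟩ := h3 h
    rw [← e4] at hA h4 h2 ⊢
    rw [← e5] at hA h2 h5 ⊢
    obtain ⟨h6, h7⟩ := run_placeBid hG1 hS hA h4 (by omega)
      fun u v huv => h5 ▸ h2 u v trivial huv
    exact ⟨h6, .inl ⟨⟨_, _, h4, by omega⟩, h7⟩⟩
  · rw [run_ite_neg (by simp only [Expr.eval]; omega), ForProg.run, e4, e5]
    exact ⟨hA, .inr fun u v huv => le_trans (by omega) (h2 u v trivial huv)⟩

/-- The auction computes the value of the linear program. -/
theorem run_auction (hG : HoldsGraph G n s) (hS : ∀ u ∈ S, u < n) (hW : HoldsSet S n 3 s) :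
    (auction.run s).var 10 = halfOpt G S ∧
      ∃ U f, IsDoubleMatching G S U f ∧ U.card = halfOpt G S := by
  rw [auction, run_seq, run_seq]
  set s1 := auctionInit.run s with hs1
  have hf1 : auctionInit.Frame s s1 := frame_run _ s
  have h1 : ∀ u < n, s1.arr 4 u = 0 ∧ s1.arr 5 u = 0 := by
    have key := run_forLoop (r := 0) (x := 4) (s := s)
      (p := .seq (.store 4 (.var 4) (.const 0)) (.store 5 (.var 4) (.const 0))) rfl
      (fun i s' => ∀ u < i, s'.arr 4 u = 0 ∧ s'.arr 5 u = 0) (by simp) ?_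
    · rwa [hG.order] at key
    · intro i s' hi hx hf hI u hu
      rcases Nat.lt_succ_iff_lt_or_eq.1 hu with hu' | rfl
      · simpa [ForProg.run, Expr.eval, hx, Function.update_apply, hu'.ne] using hI u hu'
      · simp [ForProg.run, Expr.eval, hx]
  have hG1 : HoldsGraph G n s1 := hG.frame hf1 rfl
  have hW1 : HoldsSet S n 3 s1 := by unfold HoldsSet; rw [hf1.2 3 rfl]; exact hW
  set s2 := (ForProg.forLoop 2 3 auctionStep).run s1 with hs2
  have hf2 : ForProg.Frame _ s1 s2 := frame_run _ s1
  have h2 : AuctionInv G S n (s2.arr 4) (s2.arr 5) ∧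
      ∀ u v, Bid G S (s2.arr 4) u v → n ≤ s2.arr 5 v := by
    -- Until bidding stops, each round raises the total price by at least 1. The total never exceeds
    -- `n * n`, so `n * n + 1` rounds are enough.
    have key := run_forLoop (r := 2) (x := 3) (s := s1) (p := auctionStep) rfl
      (fun i s' => AuctionInv G S n (s'.arr 4) (s'.arr 5) ∧
        (i ≤ ∑ v ∈ S, s'.arr 5 v ∨ ∀ u v, Bid G S (s'.arr 4) u v → n ≤ s'.arr 5 v)) ?_ ?_
    · rw [hG1.rounds] at key
      refine ⟨key.1, key.2.resolve_left fun hle => ?_⟩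
      have a1 : ∑ v ∈ S, s2.arr 5 v ≤ S.card * n := by
        rw [← smul_eq_mul]
        exact Finset.sum_le_card_nsmul _ _ _ key.1.price_le
      have a2 := Finset.card_le_card
        (fun u hu => Finset.mem_range.2 (hS u hu) : S ⊆ Finset.range n)
      rw [Finset.card_range] at a2
      have a3 := Nat.mul_le_mul_right n a2
      have a4 : n * n + 1 ≤ ∑ v ∈ S, s2.arr 5 v := hle
      omega
    · refine ⟨⟨fun u hu v huv => ?_, fun u hu v hv _ hne => ?_, fun v hv hp => ?_,
        fun v hv => ?_⟩, .inl (Nat.zero_le _)⟩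
      · rw [State.arr_setVar, (h1 u hu).1] at huv; omega
      · exact absurd (h1 u hu).1 hne
      · exact absurd (h1 v (hS v hv)).2 hp
      · rw [State.arr_setVar, (h1 v (hS v hv)).2]; omega
    · intro i s' hi hx hf ⟨hA, hI⟩
      have hW' : HoldsSet S n 3 s' := by unfold HoldsSet; rw [hf.2 3 rfl]; exact hW1
      obtain ⟨b1, b2⟩ := run_auctionStep (hG1.frame hf rfl) hS hW' hA
      refine ⟨b1, ?_⟩
      simp only [State.arr_setVar]
      rcases b2 with ⟨⟨u, v, hb, hlt⟩, b2⟩ | b2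
      · rcases hI with hI | hI
        · left; omega
        · exact absurd (hI u v hb) (by omega)
      · exact .inr b2
  obtain ⟨hm, hcard⟩ := h2.1.final hS h2.2
  refine ⟨?_, _, _, hm, hcard⟩
  rw [← hcard, auctionCount, run_seq]
  set s3 := (ForProg.assign 10 (.const 0)).run s2 with hs3
  have key := run_forLoop (r := 0) (x := 4) (s := s3)
    (p := .ite (cell 4 4) (.assign 10 (.add (.var 10) (.const 1))) .skip) rfl
    (fun i s' => s'.var 10 = ((Finset.range i).filter fun u => s2.arr 4 u ≠ 0).card) ?_ ?_
  · rw [key]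
    congr 3
    rw [hs3, ForProg.run, State.var_setVar, if_neg (by omega), hf2.1 0 rfl, hG1.order]
  · simp [hs3, ForProg.run, Expr.eval]
  · intro i s' hi hx hf hI
    have e4 : s'.arr 4 = s2.arr 4 := hf.2 4 rfl
    rw [Finset.range_add_one, Finset.filter_insert]
    by_cases h : s2.arr 4 i = 0
    · rw [run_ite_neg (by simpa only [cell, Expr.eval, hx, e4] using h), if_neg (by simpa using h),
        ForProg.run]
      simpa using hI
    · rw [run_ite_pos (by simpa only [cell, Expr.eval, hx, e4] using h), if_pos h,
        Finset.card_insert_of_notMem (by simp)]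
      simp [ForProg.run, Expr.eval, hI]

end

/-! ### Branching -/

section Config

variable (G : SimpleGraph ℕ) [DecidableRel G.Adj]

noncomputable instance (S : Finset ℕ) : DecidablePred (Reducible G S) :=
  fun _ => Nat.decLe _ _

/-- A configuration of the branching algorithm: the vertices that are left, the number of
vertices in the cover so far, and the choices that are left, the next one in front. -/
structure Config where
  set : Finset ℕ
  cost : ℕ
  bits : ℕ

/-- The successor of the largest member of `S`, or `0`. -/
def lastSucc (S : Finset ℕ) : ℕ := S.sup (· + 1)

/-- Put the neighbours of `v` into the cover. -/
def Config.putNbrs (σ : Config) (v : ℕ) : Config :=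
  ⟨delNbrs G σ.set v, σ.cost + (nbrs G σ.set v).card, σ.bits⟩

/-- Put `v` into the cover. -/
def Config.putVertex (σ : Config) (v : ℕ) : Config :=
  ⟨σ.set.erase v, σ.cost + 1, σ.bits⟩

/-- A step of the branching algorithm: reduce if possible, and branch otherwise, unless `br`
is `0`. -/
noncomputable def Config.step (br M : ℕ) (σ : Config) : Config :=
  if lastSucc (σ.set.filter (Reducible G σ.set)) ≠ 0 then
    σ.putNbrs G (lastSucc (σ.set.filter (Reducible G σ.set)) - 1)
  else if br ≠ 0 ∧ lastSucc σ.set ≠ 0 then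
    -- For `M` a power of 2 and `bits < M`, doubling and comparing with `M` reads off the leading
    -- binary digit; subtracting `M` removes it.
    if M ≤ σ.bits + σ.bits then
      Config.putVertex ⟨σ.set, σ.cost, σ.bits + σ.bits - M⟩ (lastSucc σ.set - 1)
    else Config.putNbrs G ⟨σ.set, σ.cost, σ.bits + σ.bits⟩ (lastSucc σ.set - 1)
  else σ

variable {G} {S : Finset ℕ}

theorem lastSucc_mem (h : lastSucc S ≠ 0) : lastSucc S - 1 ∈ S := by
  have hS : S.Nonempty := by
    by_contra hS
    rw [Finset.not_nonempty_iff_eq_empty] at hS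
    exact h (by simp [hS, lastSucc])
  obtain ⟨v, hv, e⟩ := Finset.exists_mem_eq_sup S hS (· + 1)
  rw [lastSucc, e]
  simpa using hv

theorem lastSucc_eq_zero : lastSucc S = 0 ↔ S = ∅ := by
  refine ⟨fun h => Finset.eq_empty_of_forall_notMem fun v hv => ?_, fun h => by
    simp [h, lastSucc]⟩
  have : v + 1 ≤ lastSucc S := Finset.le_sup (f := (· + 1)) hv
  omega

theorem lastSucc_filter_range_succ (P : ℕ → Prop) [DecidablePred P] (i : ℕ) :
    lastSucc ((Finset.range (i + 1)).filter P) =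
      if P i then i + 1 else lastSucc ((Finset.range i).filter P) := by
  rw [Finset.range_add_one, Finset.filter_insert]
  split_ifs
  · rw [lastSucc, Finset.sup_insert]
    refine sup_eq_left.2 (Finset.sup_le fun v hv => ?_)
    simp only [Finset.mem_filter, Finset.mem_range] at hv
    omega
  · rfl

end Config

/-! ### Programs for reduction, branching and exhaustive search -/

section

/-- Remove the vertex in register `x` and its neighbours from the set in array `a`, and add the
number of the neighbours to register `y`. -/
def removeNbrs (a x y : ℕ) : ForProg :=
  .seq (.forLoop 0 15 (.ite (adjEntry x 15)
      (.seq (.assign y (.add (.var y) (cell a 15))) (.store a (.var 15) (.const 0))) .skip))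
    (.store a (.var x) (.const 0))

/-- Copy array 2 to array 3. -/
def copySet : ForProg := .forLoop 0 16 (.store 3 (.var 16) (cell 2 16))

/-- Test whether the vertex in register 13 is reducible. -/
def testVertex : ForProg :=
  .seq (.assign 14 (.const 0)) (.seq copySet (.seq (removeNbrs 3 13 14) (.seq auction
    (.ite (.sub (.add (.var 11) (.const 1)) (.add (.var 10) (.add (.var 14) (.var 14))))
      (.assign 12 (.add (.var 13) (.const 1))) .skip))))

/-- Search for a reducible vertex. -/
def findReducible : ForProg :=
  .seq copySet (.seq auction (.seq (.assign 11 (.var 10)) (.seq (.assign 12 (.const 0))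
    (.forLoop 0 13 (.ite (cell 2 13) testVertex .skip)))))

/-- Search for any vertex. -/
def findAny : ForProg :=
  .seq (.assign 12 (.const 0))
    (.forLoop 0 13 (.ite (cell 2 13) (.assign 12 (.add (.var 13) (.const 1))) .skip))

/-- Put the neighbours of the chosen vertex into the cover. -/
def putNbrsProg : ForProg :=
  .seq (.assign 27 (.sub (.var 12) (.const 1))) (removeNbrs 2 27 17)

/-- Put the chosen vertex into the cover. -/
def putVertexProg : ForProg :=
  .seq (.store 2 (.sub (.var 12) (.const 1)) (.const 0)) (.assign 17 (.add (.var 17) (.const 1)))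

/-- Branch on the chosen vertex. -/
def branchProg : ForProg :=
  .seq (.assign 18 (.add (.var 18) (.var 18)))
    (.ite (.sub (.add (.var 18) (.const 1)) (.var 19))
      (.seq (.assign 18 (.sub (.var 18) (.var 19))) putVertexProg) putNbrsProg)

/-- A step of the branching algorithm. -/
def stepProg : ForProg :=
  .seq findReducible (.ite (.var 12) putNbrsProg
    (.ite (.var 20) (.seq findAny (.ite (.var 12) branchProg .skip)) .skip))

variable {G : SimpleGraph ℕ} [DecidableRel G.Adj] {S : Finset ℕ} {n : ℕ} {s : State}

theorem HoldsSet.congr {a : ℕ} {s' : State} (h : HoldsSet S n a s) (ha : s'.arr a = s.arr a) :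
    HoldsSet S n a s' := by
  unfold HoldsSet; rw [ha]; exact h

theorem nbrs_eq (hS : ∀ u ∈ S, u < n) (v : ℕ) :
    nbrs G S v = (Finset.range n).filter fun w => w ∈ S ∧ G.Adj v w := by
  ext w
  simp only [nbrs, Finset.mem_filter, Finset.mem_range]
  exact ⟨fun h => ⟨hS w h.1, h⟩, fun h => h.2⟩

theorem run_removeNbrs {a x y i : ℕ} (hG : HoldsGraph G n s) (hS : ∀ u ∈ S, u < n)
    (hA : HoldsSet S n a s) (ha0 : a ≠ 0) (ha1 : a ≠ 1) (hx : x ≠ 15) (hy : y ≠ 15)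
    (hxy : y ≠ x) (hi : i < n) (hxi : s.var x = i) :
    HoldsSet (delNbrs G S i) n a ((removeNbrs a x y).run s) ∧
      ((removeNbrs a x y).run s).var y = s.var y + (nbrs G S i).card := by
  have key := run_forLoop (r := 0) (x := 15) (s := s) (p := .ite (adjEntry x 15)
      (.seq (.assign y (.add (.var y) (cell a 15))) (.store a (.var 15) (.const 0))) .skip)
    (by simp [ForProg.writesVar, hy])
    (fun j s' => (∀ w < n, s'.arr a w = if w ∈ S ∧ ¬ (w < j ∧ G.Adj i w) then 1 else 0) ∧
      s'.var y = s.var y + ((Finset.range j).filter fun w => w ∈ S ∧ G.Adj i w).card) ?_ ?_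
  · rw [hG.order, ← nbrs_eq hS] at key
    rw [removeNbrs, run_seq]
    have hf := frame_run (.forLoop 0 15 (.ite (adjEntry x 15)
      (.seq (.assign y (.add (.var y) (cell a 15))) (.store a (.var 15) (.const 0))) .skip)) s
    have ex := hf.1 x (by simp [ForProg.writesVar, hxy, hx.symm])
    set s1 := (ForProg.forLoop 0 15 (.ite (adjEntry x 15)
      (.seq (.assign y (.add (.var y) (cell a 15))) (.store a (.var 15) (.const 0))) .skip)).run s
    refine ⟨fun w hw => ?_, key.2⟩
    simp only [ForProg.run, Expr.eval, State.arr_setArr, if_true, Function.update_apply, ex, hxi,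
      key.1 w hw, delNbrs, Finset.mem_filter, hw, true_and]
    by_cases h1 : w = i <;> simp [h1]
  · refine ⟨fun w hw => ?_, ?_⟩
    · simpa using hA w hw
    · simp [hy]
  · intro j s' hj hj' hf ⟨hI, hI'⟩
    rw [hG.order] at hj
    have ex := hf.1 x (by simp [ForProg.writesVar, hxy, hx.symm])
    have e0 := hf.2 0 (by simp [ForProg.writesArr, ha0])
    have e1 := hf.2 1 (by simp [ForProg.writesArr, ha1])
    have hadj : (adjEntry x 15).eval s' ≠ 0 ↔ G.Adj i j := by
      simpa only [adjEntry, Expr.eval, ex, hxi, hj', e0, e1, hG.row i hi] using hG.adj i hi j hj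
    rw [Finset.range_add_one, Finset.filter_insert]
    by_cases h : G.Adj i j
    · rw [run_ite_pos (hadj.2 h)]
      refine ⟨fun w hw => ?_, ?_⟩
      · simp only [ForProg.run, Expr.eval, State.arr_setVar, State.arr_setArr, if_true,
          State.var_setVar, if_neg hy.symm, hj', Function.update_apply]
        by_cases h1 : w = j
        · subst h1; simp [h]
        · rw [if_neg h1, hI w hw]
          congr 1
          simp only [eq_iff_iff]
          have : w < j + 1 ↔ w < j := by omega
          rw [this]
      · simp only [ForProg.run, cell, Expr.eval, State.var_setVar, State.var_setArr, if_true,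
          if_neg hy, hj', hI', hI j hj]
        by_cases h1 : j ∈ S
        · simp [h1, h, add_assoc]
        · simp [h1]
    · rw [run_ite_neg (not_not.1 (mt hadj.1 h))]
      simp only [ForProg.run, State.arr_setVar, State.var_setVar, if_neg hy]
      refine ⟨fun w hw => ?_, by simpa [h] using hI'⟩
      rw [hI w hw]
      congr 1
      simp only [eq_iff_iff]
      by_cases h1 : w = j
      · subst h1; simp [h]
      · have : w < j + 1 ↔ w < j := by omega
        rw [this]

theorem run_copySet (h0 : s.var 0 = n) (hA : HoldsSet S n 2 s) :
    HoldsSet S n 3 (copySet.run s) := by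
  have key := run_forLoop (r := 0) (x := 16) (s := s) (p := .store 3 (.var 16) (cell 2 16)) rfl
    (fun i s' => ∀ w < i, s'.arr 3 w = s.arr 2 w) (by simp) ?_
  · rw [h0] at key
    exact fun w hw => (key w hw).trans (hA w hw)
  · intro i s' hi hx hf hI w hw
    have e2 : s'.arr 2 = s.arr 2 := hf.2 2 rfl
    rcases Nat.lt_succ_iff_lt_or_eq.1 hw with hw' | rfl
    · simpa [ForProg.run, cell, Expr.eval, hx, Function.update_apply, hw'.ne] using hI w hw'
    · simp [ForProg.run, cell, Expr.eval, hx, e2]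

theorem mem_delNbrs_lt (hS : ∀ u ∈ S, u < n) (v : ℕ) : ∀ u ∈ delNbrs G S v, u < n :=
  fun u hu => hS u (Finset.mem_filter.1 hu).1

/-- Register 11 keeps the optimum of the whole set while the auction is rerun on the copy in array
3. A truncated difference `(a + 1) - b` is nonzero exactly when `b ≤ a`. -/
theorem run_testVertex {i : ℕ} (hG : HoldsGraph G n s) (hS : ∀ u ∈ S, u < n)
    (hA : HoldsSet S n 2 s) (hi : i < n) (h13 : s.var 13 = i) (h11 : s.var 11 = halfOpt G S) :
    (testVertex.run s).var 12 = if Reducible G S i then i + 1 else s.var 12 := by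
  rw [testVertex, run_seq, run_seq, run_seq, run_seq]
  set s1 := (ForProg.assign 14 (.const 0)).run s with hs1
  have hf1 : ForProg.Frame _ s s1 := frame_run _ s
  set s2 := copySet.run s1 with hs2
  have hf2 : copySet.Frame s1 s2 := frame_run _ s1
  set s3 := (removeNbrs 3 13 14).run s2 with hs3
  have hf3 : (removeNbrs 3 13 14).Frame s2 s3 := frame_run _ s2
  set s4 := auction.run s3 with hs4
  have hf4 : auction.Frame s3 s4 := frame_run _ s3
  have g1 := hG.frame hf1 rfl
  have g2 := g1.frame hf2 rfl
  have g3 := g2.frame hf3 rfl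
  have a2 : HoldsSet S n 3 s2 := run_copySet g1.order (hA.congr rfl)
  have h13' : s2.var 13 = i := (hf2.1 13 rfl).trans ((hf1.1 13 rfl).trans h13)
  obtain ⟨a3, b3⟩ := run_removeNbrs g2 hS a2 (y := 14) (x := 13) (by omega) (by omega) (by omega)
    (by omega) (by omega) hi h13'
  rw [← hs3] at a3 b3
  have a4 := (run_auction g3 (mem_delNbrs_lt hS i) a3).1
  rw [← hs4] at a4
  have c14 : s4.var 14 = (nbrs G S i).card := by
    rw [hf4.1 14 rfl, b3, hf2.1 14 rfl]
    simp [hs1, ForProg.run, Expr.eval]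
  have c (r : ℕ) (h1 : auction.writesVar r = false) (h2 : (removeNbrs 3 13 14).writesVar r = false)
      (h3 : copySet.writesVar r = false) (h4 : r ≠ 14) : s4.var r = s.var r := by
    rw [hf4.1 r h1, hf3.1 r h2, hf2.1 r h3]
    simp [hs1, ForProg.run, h4]
  have c11 := (c 11 rfl rfl rfl (by omega)).trans h11
  have c12 := c 12 rfl rfl rfl (by omega)
  have c13 := (c 13 rfl rfl rfl (by omega)).trans h13
  by_cases h : Reducible G S i
  · rw [if_pos h]
    unfold Reducible at h
    rw [run_ite_pos (by simp only [Expr.eval, a4, c11, c14]; omega)]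
    simp [ForProg.run, Expr.eval, c13]
  · rw [if_neg h]
    unfold Reducible at h
    rw [run_ite_neg (by simp only [Expr.eval, a4, c11, c14]; omega), ForProg.run]
    exact c12

theorem filter_range_mem_and (hS : ∀ u ∈ S, u < n) (P : ℕ → Prop) [DecidablePred P] :
    ((Finset.range n).filter fun u => u ∈ S ∧ P u) = S.filter P := by
  ext w
  simp only [Finset.mem_filter, Finset.mem_range]
  exact ⟨fun h => h.2, fun h => ⟨hS w h.1, h⟩⟩

theorem run_findReducible (hG : HoldsGraph G n s) (hS : ∀ u ∈ S, u < n)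
    (hA : HoldsSet S n 2 s) :
    (findReducible.run s).var 12 = lastSucc (S.filter (Reducible G S)) := by
  rw [findReducible, run_seq, run_seq, run_seq, run_seq]
  set s1 := copySet.run s with hs1
  have hf1 : copySet.Frame s s1 := frame_run _ s
  set s2 := auction.run s1 with hs2
  have hf2 : auction.Frame s1 s2 := frame_run _ s1
  set s3 := (ForProg.assign 11 (.var 10)).run s2 with hs3
  have hf3 : ForProg.Frame _ s2 s3 := frame_run _ s2
  set s4 := (ForProg.assign 12 (.const 0)).run s3 with hs4
  have hf4 : ForProg.Frame _ s3 s4 := frame_run _ s3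
  have g1 := hG.frame hf1 rfl
  have g4 := ((g1.frame hf2 rfl).frame hf3 rfl).frame hf4 rfl
  have a2 := (run_auction g1 hS (run_copySet hG.order hA)).1
  rw [← hs2] at a2
  have c11 : s4.var 11 = halfOpt G S := by
    rw [hf4.1 11 rfl, hs3, ← a2]
    simp [ForProg.run, Expr.eval]
  have a4 : HoldsSet S n 2 s4 :=
    (((hA.congr (hf1.2 2 rfl)).congr (hf2.2 2 rfl)).congr (hf3.2 2 rfl)).congr (hf4.2 2 rfl)
  have key := run_forLoop (r := 0) (x := 13) (s := s4) (p := .ite (cell 2 13) testVertex .skip)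
    rfl (fun i s' => s'.var 12 =
      lastSucc ((Finset.range i).filter fun u => u ∈ S ∧ Reducible G S u)) ?_ ?_
  · rw [key, g4.order, filter_range_mem_and hS]
  · simp [hs4, ForProg.run, Expr.eval, lastSucc]
  · intro i s' hi hx hf hI
    rw [g4.order] at hi
    have a' : HoldsSet S n 2 s' := a4.congr (hf.2 2 rfl)
    rw [lastSucc_filter_range_succ]
    by_cases h : i ∈ S
    · rw [run_ite_pos (by simp [cell, Expr.eval, hx, a' i hi, h])]
      rw [State.var_setVar, if_neg (by omega), run_testVertex (g4.frame hf rfl) hS a' hi hx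
        ((hf.1 11 rfl).trans c11), hI]
      simp [h]
    · rw [run_ite_neg (by simp [cell, Expr.eval, hx, a' i hi, h]), if_neg (by simp [h]),
        ForProg.run, State.var_setVar, if_neg (by omega), hI]

theorem run_findAny (h0 : s.var 0 = n) (hS : ∀ u ∈ S, u < n) (hA : HoldsSet S n 2 s) :
    (findAny.run s).var 12 = lastSucc S := by
  rw [findAny, run_seq]
  set s1 := (ForProg.assign 12 (.const 0)).run s with hs1
  have hf1 : ForProg.Frame _ s s1 := frame_run _ s
  have g1 : s1.var 0 = n := (hf1.1 0 rfl).trans h0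
  have key := run_forLoop (r := 0) (x := 13) (s := s1)
    (p := .ite (cell 2 13) (.assign 12 (.add (.var 13) (.const 1))) .skip)
    rfl (fun i s' => s'.var 12 = lastSucc ((Finset.range i).filter (· ∈ S))) ?_ ?_
  · rw [key, g1]
    congr 1
    ext w
    simp only [Finset.mem_filter, Finset.mem_range]
    exact ⟨fun h => h.2, fun h => ⟨hS w h, h⟩⟩
  · simp [hs1, ForProg.run, Expr.eval, lastSucc]
  · intro i s' hi hx hf hI
    rw [g1] at hi
    have a' : HoldsSet S n 2 s' := (hA.congr (hf1.2 2 rfl)).congr (hf.2 2 rfl)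
    rw [lastSucc_filter_range_succ]
    by_cases h : i ∈ S
    · rw [run_ite_pos (by simp [cell, Expr.eval, hx, a' i hi, h]), if_pos h]
      simp [ForProg.run, Expr.eval, hx]
    · rw [run_ite_neg (by simp [cell, Expr.eval, hx, a' i hi, h]), if_neg h,
        ForProg.run, State.var_setVar, if_neg (by omega), hI]

/-- The memory `s` holds the configuration `σ`. -/
structure HoldsConfig (σ : Config) (n : ℕ) (s : State) : Prop where
  mem_lt : ∀ u ∈ σ.set, u < n
  set : HoldsSet σ.set n 2 s
  cost : s.var 17 = σ.cost
  bits : s.var 18 = σ.bits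

variable {σ : Config}

theorem HoldsConfig.congr {s' : State} (h : HoldsConfig σ n s) (h2 : s'.arr 2 = s.arr 2)
    (h17 : s'.var 17 = s.var 17) (h18 : s'.var 18 = s.var 18) : HoldsConfig σ n s' :=
  ⟨h.mem_lt, h.set.congr h2, h17.trans h.cost, h18.trans h.bits⟩

theorem run_putNbrsProg (hG : HoldsGraph G n s) (hσ : HoldsConfig σ n s)
    (h12 : s.var 12 - 1 < n) : HoldsConfig (σ.putNbrs G (s.var 12 - 1)) n (putNbrsProg.run s) := by
  rw [putNbrsProg, run_seq]
  set s1 := (ForProg.assign 27 (.sub (.var 12) (.const 1))).run s with hs1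
  have hf1 : ForProg.Frame _ s s1 := frame_run _ s
  have hσ1 : HoldsConfig σ n s1 := hσ.congr (hf1.2 2 rfl) (hf1.1 17 rfl) (hf1.1 18 rfl)
  obtain ⟨h1, h2⟩ := run_removeNbrs (hG.frame hf1 rfl) hσ1.mem_lt hσ1.set (x := 27) (y := 17)
    (by omega) (by omega) (by omega) (by omega) (by omega) h12
    (by simp [hs1, ForProg.run, Expr.eval])
  refine ⟨mem_delNbrs_lt hσ.mem_lt _, h1, ?_, ?_⟩
  · rw [h2, hσ1.cost]; rfl
  · rw [var_run rfl, hσ1.bits]; rfl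

theorem run_putVertexProg (hσ : HoldsConfig σ n s) :
    HoldsConfig (σ.putVertex (s.var 12 - 1)) n (putVertexProg.run s) := by
  refine ⟨fun u hu => hσ.mem_lt u (Finset.mem_of_mem_erase hu), fun w hw => ?_, ?_, ?_⟩
  · simp only [putVertexProg, ForProg.run, Expr.eval, State.arr_setVar, State.arr_setArr, if_true,
      Function.update_apply, hσ.set w hw, Config.putVertex, Finset.mem_erase]
    by_cases h : w = s.var 12 - 1 <;> simp [h]
  · simp [putVertexProg, ForProg.run, Expr.eval, hσ.cost, Config.putVertex]
  · simp [putVertexProg, ForProg.run, hσ.bits, Config.putVertex]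

theorem run_stepProg (hG : HoldsGraph G n s) (hσ : HoldsConfig σ n s) :
    HoldsConfig (σ.step G (s.var 20) (s.var 19)) n (stepProg.run s) := by
  rw [stepProg, run_seq]
  have h12 := run_findReducible hG hσ.mem_lt hσ.set
  set s1 := findReducible.run s with hs1
  have hf1 : findReducible.Frame s s1 := frame_run _ s
  have hG1 := hG.frame hf1 rfl
  have hσ1 : HoldsConfig σ n s1 := hσ.congr (hf1.2 2 rfl) (hf1.1 17 rfl) (hf1.1 18 rfl)
  have e19 : s1.var 19 = s.var 19 := hf1.1 19 rfl
  have e20 : s1.var 20 = s.var 20 := hf1.1 20 rfl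
  rw [Config.step]
  by_cases h : lastSucc (σ.set.filter (Reducible G σ.set)) = 0
  swap
  · rw [if_pos h, run_ite_pos (by simpa only [Expr.eval, h12] using h), ← h12]
    refine run_putNbrsProg hG1 hσ1 (hσ.mem_lt _ ?_)
    rw [h12]
    exact (Finset.mem_filter.1 (lastSucc_mem h)).1
  rw [if_neg (not_not.2 h), run_ite_neg (by simpa only [Expr.eval, h12] using h)]
  by_cases hbr : s.var 20 = 0
  · rw [if_neg (by simp [hbr]), run_ite_neg (by simpa only [Expr.eval, e20] using hbr), ForProg.run]
    exact hσ1
  rw [run_ite_pos (by simpa only [Expr.eval, e20] using hbr), run_seq]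
  have h12' := run_findAny hG1.order hσ1.mem_lt hσ1.set
  set s2 := findAny.run s1 with hs2
  have hf2 : findAny.Frame s1 s2 := frame_run _ s1
  have hG2 := hG1.frame hf2 rfl
  have hσ2 : HoldsConfig σ n s2 := hσ1.congr (hf2.2 2 rfl) (hf2.1 17 rfl) (hf2.1 18 rfl)
  by_cases h' : lastSucc σ.set = 0
  · rw [if_neg (by simp [h']), run_ite_neg (by simpa only [Expr.eval, h12'] using h'), ForProg.run]
    exact hσ2
  rw [if_pos ⟨hbr, h'⟩, run_ite_pos (by simpa only [Expr.eval, h12'] using h'), branchProg, run_seq]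
  set s3 := (ForProg.assign 18 (.add (.var 18) (.var 18))).run s2 with hs3
  have hf3 : ForProg.Frame _ s2 s3 := frame_run _ s2
  have e19' : s3.var 19 = s.var 19 := (hf3.1 19 rfl).trans ((hf2.1 19 rfl).trans e19)
  have e12 : s3.var 12 = lastSucc σ.set := (hf3.1 12 rfl).trans h12'
  have e18 : s3.var 18 = σ.bits + σ.bits := by
    simp [hs3, ForProg.run, Expr.eval, hσ2.bits]
  have hσ3 : HoldsConfig ⟨σ.set, σ.cost, σ.bits + σ.bits⟩ n s3 :=
    ⟨hσ.mem_lt, hσ2.set.congr (hf3.2 2 rfl), (hf3.1 17 rfl).trans hσ2.cost, e18⟩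
  by_cases hM : s.var 19 ≤ σ.bits + σ.bits
  · rw [if_pos hM, run_ite_pos (by simp only [Expr.eval, e18, e19']; omega), run_seq]
    have hσ4 : HoldsConfig ⟨σ.set, σ.cost, σ.bits + σ.bits - s.var 19⟩ n
        ((ForProg.assign 18 (.sub (.var 18) (.var 19))).run s3) :=
      ⟨hσ.mem_lt, hσ3.set, hσ3.cost, by simp [ForProg.run, Expr.eval, e18, e19']⟩
    have := run_putVertexProg hσ4
    rwa [var_run rfl, e12] at this
  · rw [if_neg hM, run_ite_neg (by simp only [Expr.eval, e18, e19']; omega), ← e12]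
    refine run_putNbrsProg (hG2.frame hf3 rfl) hσ3 (hσ.mem_lt _ ?_)
    rw [e12]
    exact lastSucc_mem h'

/-- Run the branching algorithm with the choices in register 21. -/
def guidedRun : ForProg :=
  .seq (.forLoop 0 16 (.store 2 (.var 16) (.const 1))) (.seq (.assign 17 (.const 0))
    (.seq (.assign 18 (.var 21)) (.forLoop 0 22 stepProg)))

/-- Set register 23 if a vertex cover of size at most register 1 has been found. -/
def checkRun : ForProg :=
  .seq (.assign 28 (.const 0)) (.seq (.forLoop 0 16 (.assign 28 (.add (.var 28) (cell 2 16))))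
    (.ite (.var 28) .skip (.ite (.sub (.var 17) (.var 1)) .skip (.assign 23 (.const 1)))))

/-- Run the branching algorithm with all possible choices. -/
def searchProg : ForProg :=
  .seq (.assign 23 (.const 0)) (.forLoop 19 21 (.seq guidedRun checkRun))

variable (G) in
/-- The result of the branching algorithm with the choices `b`. -/
noncomputable def runConfig (n br M b : ℕ) : Config :=
  (Config.step G br M)^[n] ⟨Finset.range n, 0, b⟩

theorem run_guidedRun (hG : HoldsGraph G n s) :
    HoldsConfig (runConfig G n (s.var 20) (s.var 19) (s.var 21)) n (guidedRun.run s) := by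
  rw [guidedRun, run_seq, run_seq, run_seq]
  set s1 := (ForProg.forLoop 0 16 (.store 2 (.var 16) (.const 1))).run s with hs1
  have hf1 : ForProg.Frame _ s s1 := frame_run _ s
  set s2 := (ForProg.assign 17 (.const 0)).run s1 with hs2
  have hf2 : ForProg.Frame _ s1 s2 := frame_run _ s1
  set s3 := (ForProg.assign 18 (.var 21)).run s2 with hs3
  have hf3 : ForProg.Frame _ s2 s3 := frame_run _ s2
  have hG3 := ((hG.frame hf1 rfl).frame hf2 rfl).frame hf3 rfl
  have h1 : ∀ w < n, s1.arr 2 w = 1 := by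
    have key := run_forLoop (r := 0) (x := 16) (s := s) (p := .store 2 (.var 16) (.const 1)) rfl
      (fun i s' => ∀ w < i, s'.arr 2 w = 1) (by simp) ?_
    · rwa [hG.order] at key
    · intro i s' hi hx hf hI w hw
      rcases Nat.lt_succ_iff_lt_or_eq.1 hw with hw' | rfl
      · simpa [ForProg.run, Expr.eval, hx, Function.update_apply, hw'.ne] using hI w hw'
      · simp [ForProg.run, Expr.eval, hx]
  have e (r : ℕ) (h16 : r ≠ 16) (h17 : r ≠ 17) (h18 : r ≠ 18) : s3.var r = s.var r := by
    rw [hf3.1 r (by simp [ForProg.writesVar, h18.symm]),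
      hf2.1 r (by simp [ForProg.writesVar, h17.symm]),
      hf1.1 r (by simp [ForProg.writesVar, h16.symm])]
  have key := run_forLoop (r := 0) (x := 22) (s := s3) (p := stepProg) rfl
    (fun i s' => HoldsConfig
      ((Config.step G (s.var 20) (s.var 19))^[i] ⟨Finset.range n, 0, s.var 21⟩) n s') ?_ ?_
  · rwa [hG3.order] at key
  · refine ⟨fun u hu => Finset.mem_range.1 hu, fun w hw => ?_, ?_, ?_⟩
    · rw [State.arr_setVar, hf3.2 2 rfl, hf2.2 2 rfl, h1 w hw]
      simp [hw]
    · simp [hs3, hs2, ForProg.run, Expr.eval]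
    · rw [State.var_setVar, if_neg (by omega), hs3]
      simp only [ForProg.run, Expr.eval, State.var_setVar, if_true, Function.iterate_zero, id]
      rw [hf2.1 21 rfl, hf1.1 21 rfl]
  · intro i s' hi hx hf hI
    have := run_stepProg (hG3.frame hf rfl) hI
    rw [hf.1 20 rfl, hf.1 19 rfl, e 20 (by omega) (by omega) (by omega),
      e 19 (by omega) (by omega) (by omega)] at this
    rw [Function.iterate_succ_apply']
    exact this.congr rfl rfl rfl

theorem run_checkRun (h0 : s.var 0 = n) (hσ : HoldsConfig σ n s) :
    (checkRun.run s).var 23 = if σ.set = ∅ ∧ σ.cost ≤ s.var 1 then 1 else s.var 23 := by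
  rw [checkRun, run_seq, run_seq]
  set s1 := (ForProg.assign 28 (.const 0)).run s with hs1
  have hf1 : ForProg.Frame _ s s1 := frame_run _ s
  set s2 := (ForProg.forLoop 0 16 (.assign 28 (.add (.var 28) (cell 2 16)))).run s1 with hs2
  have hf2 : ForProg.Frame _ s1 s2 := frame_run _ s1
  have e0 : s1.var 0 = n := (hf1.1 0 rfl).trans h0
  have h28 : s2.var 28 = ((Finset.range n).filter (· ∈ σ.set)).card := by
    have key := run_forLoop (r := 0) (x := 16) (s := s1)
      (p := .assign 28 (.add (.var 28) (cell 2 16))) rfl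
      (fun i s' => s'.var 28 = ((Finset.range i).filter (· ∈ σ.set)).card) ?_ ?_
    · rwa [e0] at key
    · simp [hs1, ForProg.run, Expr.eval]
    · intro i s' hi hx hf hI
      have e2 : s'.arr 2 = s.arr 2 := (hf.2 2 rfl).trans (hf1.2 2 rfl)
      rw [Finset.range_add_one, Finset.filter_insert]
      simp only [ForProg.run, cell, Expr.eval, State.var_setVar, hx, e2, hI, if_true,
        hσ.set i (e0 ▸ hi), show ¬ (28 = 16) by omega, if_false]
      split_ifs
      · rw [Finset.card_insert_of_notMem (by simp)]
      · rfl
  have c (r : ℕ) (h16 : r ≠ 16) (h28 : r ≠ 28) : s2.var r = s.var r := by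
    rw [hf2.1 r (by simp [ForProg.writesVar, h16.symm, h28.symm]),
      hf1.1 r (by simp [ForProg.writesVar, h28.symm])]
  have hempty : s2.var 28 = 0 ↔ σ.set = ∅ := by
    rw [h28, Finset.card_eq_zero, Finset.filter_eq_empty_iff]
    refine ⟨fun h => Finset.eq_empty_of_forall_notMem fun v hv =>
      h (Finset.mem_range.2 (hσ.mem_lt v hv)) hv, fun h => by simp [h]⟩
  by_cases h1 : σ.set = ∅
  swap
  · rw [run_ite_pos (by simpa only [Expr.eval] using mt hempty.1 h1), if_neg (fun h => h1 h.1),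
      ForProg.run, c 23 (by omega) (by omega)]
  rw [run_ite_neg (by simpa only [Expr.eval] using hempty.2 h1)]
  have c17 := (c 17 (by omega) (by omega)).trans hσ.cost
  have c1 := c 1 (by omega) (by omega)
  by_cases h2 : σ.cost ≤ s.var 1
  · rw [run_ite_neg (by simp only [Expr.eval, c17, c1]; omega), if_pos ⟨h1, h2⟩]
    simp [ForProg.run, Expr.eval]
  · rw [run_ite_pos (by simp only [Expr.eval, c17, c1]; omega), if_neg (fun h => h2 h.2),
      ForProg.run, c 23 (by omega) (by omega)]

/-- The same program serves both cases. With a single choice sequence its only run leaves its final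
configuration in memory, and the kernel is read from there. -/
theorem run_searchProg (hG : HoldsGraph G n s) :
    ((searchProg.run s).var 23 ≠ 0 ↔ ∃ b < s.var 19,
      (runConfig G n (s.var 20) (s.var 19) b).set = ∅ ∧
        (runConfig G n (s.var 20) (s.var 19) b).cost ≤ s.var 1) ∧
    (s.var 19 = 1 →
      HoldsConfig (runConfig G n (s.var 20) (s.var 19) 0) n (searchProg.run s)) := by
  rw [searchProg, run_seq]
  set s1 := (ForProg.assign 23 (.const 0)).run s with hs1
  have hf1 : ForProg.Frame _ s s1 := frame_run _ s
  have hG1 := hG.frame hf1 rfl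
  have key := run_forLoop (r := 19) (x := 21) (s := s1) (p := .seq guidedRun checkRun) rfl
    (fun i s' => (s'.var 23 ≠ 0 ↔ ∃ b < i,
      (runConfig G n (s.var 20) (s.var 19) b).set = ∅ ∧
        (runConfig G n (s.var 20) (s.var 19) b).cost ≤ s.var 1) ∧
      (i = 1 → HoldsConfig (runConfig G n (s.var 20) (s.var 19) 0) n s')) ?_ ?_
  · have e : s1.var 19 = s.var 19 := hf1.1 19 rfl
    rwa [e] at key
  · simp [hs1, ForProg.run, Expr.eval]
  · intro i s' hi hx hf ⟨hI, _⟩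
    have hG' := hG1.frame hf rfl
    have hc := run_guidedRun hG'
    have c (r : ℕ) (h : (ForProg.forLoop 19 21 (.seq guidedRun checkRun)).writesVar r = false)
        (h' : r ≠ 23) : s'.var r = s.var r := by
      rw [hf.1 r h, hf1.1 r (by simp [ForProg.writesVar, h'.symm])]
    rw [c 20 rfl (by omega), c 19 rfl (by omega), hx] at hc
    have hr := run_checkRun (by rw [var_run rfl]; exact hG'.order) hc
    rw [var_run (p := guidedRun) rfl, var_run (p := guidedRun) rfl, c 1 rfl (by omega)] at hr
    rw [run_seq]
    refine ⟨?_, fun h => ?_⟩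
    · rw [State.var_setVar, if_neg (by omega), hr]
      split_ifs with h
      · exact iff_of_true (by omega) ⟨i, by omega, h⟩
      · rw [hI]
        refine ⟨fun ⟨b, hb, h'⟩ => ⟨b, by omega, h'⟩, fun ⟨b, hb, h'⟩ => ⟨b, ?_, h'⟩⟩
        have : b ≠ i := fun e => h (e ▸ h')
        omega
    · obtain rfl : i = 0 := by omega
      refine hc.congr ?_ ?_ ?_
      · rw [State.arr_setVar, arr_run rfl]
      · rw [State.var_setVar, if_neg (by omega), var_run rfl]
      · rw [State.var_setVar, if_neg (by omega), var_run rfl]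

end

/-! ### Correctness of the branching algorithm -/

section

variable {G : SimpleGraph ℕ} [DecidableRel G.Adj] {br M : ℕ} {σ : Config}

theorem step_reducible (h : lastSucc (σ.set.filter (Reducible G σ.set)) ≠ 0) :
    ∃ v ∈ σ.set, Reducible G σ.set v ∧
      ∀ c b, Config.step G br M ⟨σ.set, c, b⟩ = Config.putNbrs G ⟨σ.set, c, b⟩ v :=
  ⟨_, (Finset.mem_filter.1 (lastSucc_mem h)).1, (Finset.mem_filter.1 (lastSucc_mem h)).2,
    fun c b => by rw [Config.step, if_pos h]⟩

theorem irreducible_of_lastSucc (h : lastSucc (σ.set.filter (Reducible G σ.set)) = 0) :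
    ∀ v ∈ σ.set, ¬ Reducible G σ.set v := by
  rw [lastSucc_eq_zero, Finset.filter_eq_empty_iff] at h
  exact fun v hv => h hv

theorem step_irreducible (hirr : ∀ v ∈ σ.set, ¬ Reducible G σ.set v)
    (hne : σ.set.Nonempty) (hbr : br ≠ 0) :
    ∃ v ∈ σ.set, ∀ c b, Config.step G br M ⟨σ.set, c, b⟩ =
      if M ≤ b + b then Config.putVertex ⟨σ.set, c, b + b - M⟩ v
      else Config.putNbrs G ⟨σ.set, c, b + b⟩ v := by
  have h : lastSucc (σ.set.filter (Reducible G σ.set)) = 0 := by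
    rw [lastSucc_eq_zero, Finset.filter_eq_empty_iff]
    exact fun v hv => hirr v hv
  have h' : lastSucc σ.set ≠ 0 := by
    rw [ne_eq, lastSucc_eq_zero]
    exact hne.ne_empty
  refine ⟨_, lastSucc_mem h', fun c b => ?_⟩
  rw [Config.step, if_neg (not_not.2 h), if_pos ⟨hbr, h'⟩]

theorem step_of_irreducible (hirr : ∀ v ∈ σ.set, ¬ Reducible G σ.set v)
    (hbr : br = 0 ∨ σ.set = ∅) : σ.step G br M = σ := by
  have h : lastSucc (σ.set.filter (Reducible G σ.set)) = 0 := by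
    rw [lastSucc_eq_zero, Finset.filter_eq_empty_iff]
    exact fun v hv => hirr v hv
  rw [Config.step, if_neg (not_not.2 h), if_neg]
  rintro ⟨h1, h2⟩
  rcases hbr with hbr | hbr
  · exact h1 hbr
  · exact h2 (lastSucc_eq_zero.2 hbr)

/-- A step either puts one vertex into the cover or all the neighbours of one vertex, or does
nothing. -/
theorem step_cases (br M : ℕ) (σ : Config) :
    (∃ v b, σ.step G br M = Config.putNbrs G ⟨σ.set, σ.cost, b⟩ v) ∨
      (∃ v b, σ.step G br M = Config.putVertex ⟨σ.set, σ.cost, b⟩ v) ∨ σ.step G br M = σ := by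
  rw [Config.step]
  split_ifs
  · exact .inl ⟨_, _, rfl⟩
  · exact .inr (.inl ⟨_, _, rfl⟩)
  · exact .inl ⟨_, _, rfl⟩
  · exact .inr (.inr rfl)

/-- A vertex cover of what is left gives a vertex cover of what there was. -/
theorem exists_covers_of_step {C : Finset ℕ} (hC : Covers G (σ.step G br M).set C) :
    ∃ C', Covers G σ.set C' ∧ C'.card + σ.cost ≤ C.card + (σ.step G br M).cost := by
  rcases step_cases (G := G) br M σ with ⟨v, b, h⟩ | ⟨v, b, h⟩ | h
  · rw [h] at hC ⊢
    refine ⟨_, Covers.union_nbrs hC, ?_⟩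
    have := Finset.card_union_le C (nbrs G σ.set v)
    simp only [Config.putNbrs]
    omega
  · rw [h] at hC ⊢
    refine ⟨_, Covers.insert hC, ?_⟩
    have := Finset.card_insert_le v C
    simp only [Config.putVertex]
    omega
  · rw [h] at hC ⊢
    exact ⟨C, hC, le_rfl⟩

/-- Soundness for arbitrary choices: every step can be undone at the recorded cost. -/
theorem exists_covers_of_iterate (m : ℕ) {C : Finset ℕ}
    (hC : Covers G ((Config.step G br M)^[m] σ).set C) :
    ∃ C', Covers G σ.set C' ∧
      C'.card + σ.cost ≤ C.card + ((Config.step G br M)^[m] σ).cost := by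
  induction m generalizing C with
  | zero => exact ⟨C, hC, le_rfl⟩
  | succ m ih =>
    rw [Function.iterate_succ_apply'] at hC ⊢
    obtain ⟨C₁, h1, h2⟩ := exists_covers_of_step hC
    obtain ⟨C₂, h3, h4⟩ := ih h1
    exact ⟨C₂, h3, by omega⟩

/-- With the right choices the branching algorithm finds a vertex cover that is at most as large
as a given one. -/
theorem exists_bits (hbr : br ≠ 0) (m d e : ℕ) (he : e ≤ d) (S C : Finset ℕ) (c : ℕ)
    (hm : S.card ≤ m) (hC : Covers G S C) (hgap : 2 * C.card ≤ halfOpt G S + e) :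
    -- The `e` choices still available are the digits of `b`, shifted to the leading positions of a
    -- word of length `d`. The number `e` bounds twice the gap between `C` and the linear program.
    ∃ b < 2 ^ e, ((Config.step G br (2 ^ d))^[m] ⟨S, c, b * 2 ^ (d - e)⟩).set = ∅ ∧
      ((Config.step G br (2 ^ d))^[m] ⟨S, c, b * 2 ^ (d - e)⟩).cost ≤ c + C.card := by
  induction m generalizing e S C c with
  | zero =>
    have hS : S = ∅ := by simpa using hm
    exact ⟨0, by positivity, hS, Nat.le_add_right _ _⟩
  | succ m ih =>
    rcases S.eq_empty_or_nonempty with rfl | hne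
    · refine ⟨0, by positivity, ?_⟩
      have : Config.step G br (2 ^ d) ⟨∅, c, 0 * 2 ^ (d - e)⟩ = ⟨∅, c, 0 * 2 ^ (d - e)⟩ :=
        step_of_irreducible (fun v hv => absurd hv (Finset.notMem_empty v)) (.inr rfl)
      rw [Function.iterate_fixed this]
      exact ⟨rfl, Nat.le_add_right _ _⟩
    simp only [Function.iterate_succ_apply]
    by_cases hred : lastSucc (S.filter (Reducible G S)) = 0
    swap
    · obtain ⟨v, hv, hr, hstep⟩ := step_reducible (G := G) (br := br) (M := 2 ^ d)
        (σ := ⟨S, c, 0⟩) hred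
      replace hv : v ∈ S := hv
      replace hr : Reducible G S v := hr
      obtain ⟨C', h1, h2⟩ := hr.exists_covers hv hC
      have h3 := halfOpt_le_delNbrs_add (G := G) hv
      have h4 := card_eq_delNbrs_add (G := G) hv
      obtain ⟨b, hb, h5, h6⟩ := ih e he (delNbrs G S v) C' (c + (nbrs G S v).card) (by omega) h1
        (by omega)
      refine ⟨b, hb, ?_⟩
      rw [hstep]
      exact ⟨h5, h6.trans (by omega)⟩
    · have hirr := irreducible_of_lastSucc (σ := ⟨S, c, 0⟩) hred
      obtain ⟨v, hv, hstep⟩ := step_irreducible (M := 2 ^ d) hirr hne hbr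
      simp only at hv hstep
      by_cases hvC : v ∈ C
      · have h1 := halfOpt_lt_erase_add hirr hv
        have h2 := hC.erase v
        have h3 := h2.halfOpt_le
        rw [Finset.card_erase_of_mem hvC] at h3
        have h0 : 0 < C.card := Finset.card_pos.2 ⟨v, hvC⟩
        simp only at h1
        obtain ⟨e, rfl⟩ : ∃ e', e = e' + 1 := ⟨e - 1, by omega⟩
        obtain ⟨b, hb, h5, h6⟩ := ih e (by omega) (S.erase v) (C.erase v) (c + 1)
          (by rw [Finset.card_erase_of_mem hv]; omega) h2
          (by rw [Finset.card_erase_of_mem hvC]; omega)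
        rw [Finset.card_erase_of_mem hvC] at h6
        -- The summand `2 ^ e` is a leading digit 1, which selects the branch that takes `v`.
        have e1 : (b + 2 ^ e) * 2 ^ (d - (e + 1)) + (b + 2 ^ e) * 2 ^ (d - (e + 1)) =
            b * 2 ^ (d - e) + 2 ^ d := by
          obtain ⟨k, rfl⟩ := Nat.exists_eq_add_of_le he
          have a1 : e + 1 + k - (e + 1) = k := by omega
          have a2 : e + 1 + k - e = k + 1 := by omega
          rw [a1, a2]; ring
        refine ⟨b + 2 ^ e, by rw [pow_succ]; omega, ?_⟩
        rw [hstep, e1, if_pos (by omega), Nat.add_sub_cancel]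
        exact ⟨h5, h6.trans (by omega)⟩
      -- A cover avoiding `v` contains its neighbours. Irreducibility says that twice their number
      -- exceeds the resulting drop of the optimum, so again `e` drops by 1. The leading digit is 0.
      · have h1 := hirr v hv
        rw [Reducible] at h1
        obtain ⟨C', h2, h3⟩ := hC.delNbrs hv hvC
        have h4 := h2.halfOpt_le
        have h7 := card_eq_delNbrs_add (G := G) hv
        simp only at h1
        obtain ⟨e, rfl⟩ : ∃ e', e = e' + 1 := ⟨e - 1, by omega⟩
        obtain ⟨b, hb, h5, h6⟩ := ih e (by omega) (delNbrs G S v) C' (c + (nbrs G S v).card)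
          (by omega) h2 (by omega)
        have e1 : b * 2 ^ (d - (e + 1)) + b * 2 ^ (d - (e + 1)) = b * 2 ^ (d - e) := by
          have a2 : d - e = d - (e + 1) + 1 := by omega
          rw [a2]; ring
        have e2 : b * 2 ^ (d - e) < 2 ^ d := by
          calc b * 2 ^ (d - e) < 2 ^ e * 2 ^ (d - e) :=
                Nat.mul_lt_mul_of_pos_right hb (by positivity)
            _ = 2 ^ d := by rw [← pow_add]; congr 1; omega
        refine ⟨b, by rw [pow_succ]; omega, ?_⟩
        rw [hstep, e1, if_neg (by omega)]
        exact ⟨h5, h6.trans (by omega)⟩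

/-- The branching algorithm decides whether there is a small vertex cover. -/
theorem exists_runConfig_iff {n k d : ℕ} (hbr : br ≠ 0)
    (hd : 2 * k ≤ halfOpt G (Finset.range n) + d) :
    (∃ b < 2 ^ d, (runConfig G n br (2 ^ d) b).set = ∅ ∧
        (runConfig G n br (2 ^ d) b).cost ≤ k) ↔
      ∃ C, Covers G (Finset.range n) C ∧ C.card ≤ k := by
  constructor
  · rintro ⟨b, -, h1, h2⟩
    obtain ⟨C, h3, h4⟩ := exists_covers_of_iterate (G := G) (br := br) (M := 2 ^ d)
      (σ := ⟨Finset.range n, 0, b⟩) n (C := ∅) (by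
        change Covers G (runConfig G n br (2 ^ d) b).set ∅
        rw [h1]
        exact fun u hu => absurd hu (Finset.notMem_empty u))
    change C.card + 0 ≤ 0 + (runConfig G n br (2 ^ d) b).cost at h4
    exact ⟨C, h3, by omega⟩
  · rintro ⟨C, h1, h2⟩
    obtain ⟨b, hb, h3, h4⟩ := exists_bits hbr n d d le_rfl (Finset.range n) C 0 (by simp) h1
      (by omega)
    rw [Nat.sub_self, pow_zero, mul_one] at h3 h4
    exact ⟨b, hb, h3, by rw [runConfig]; omega⟩

/-- The first clause says that reduction preserves the gap: for a reducible vertex the inequality of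
`halfOpt_le_delNbrs_add` is an equality. -/
theorem step_zero_spec (σ : Config) :
    halfOpt G (σ.step G 0 M).set + 2 * (σ.step G 0 M).cost = halfOpt G σ.set + 2 * σ.cost ∧
      (∀ C, Covers G σ.set C → ∃ C', Covers G (σ.step G 0 M).set C' ∧
        C'.card + (σ.step G 0 M).cost ≤ C.card + σ.cost) ∧
      ((∀ v ∈ σ.set, ¬ Reducible G σ.set v) ∧ σ.step G 0 M = σ ∨
        (σ.step G 0 M).set.card < σ.set.card) := by
  by_cases hred : lastSucc (σ.set.filter (Reducible G σ.set)) = 0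
  · have hirr := irreducible_of_lastSucc hred
    have h : σ.step G 0 M = σ := step_of_irreducible hirr (.inl rfl)
    rw [h]
    exact ⟨rfl, fun C hC => ⟨C, hC, le_rfl⟩, .inl ⟨hirr, rfl⟩⟩
  · obtain ⟨v, hv, hr, hstep⟩ := step_reducible (G := G) (br := 0) (M := M) hred
    have h := hstep σ.cost σ.bits
    change σ.step G 0 M = _ at h
    rw [h]
    simp only [Config.putNbrs]
    have h1 := halfOpt_le_delNbrs_add (G := G) hv
    have h2 := card_eq_delNbrs_add (G := G) hv
    refine ⟨?_, fun C hC => ?_, .inr (by omega)⟩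
    · rw [Reducible] at hr
      omega
    · obtain ⟨C', h3, h4⟩ := hr.exists_covers hv hC
      exact ⟨C', h3, by omega⟩

/-- Reduction without branching. -/
theorem runConfig_zero (n M b : ℕ) :
    halfOpt G (runConfig G n 0 M b).set + 2 * (runConfig G n 0 M b).cost =
        halfOpt G (Finset.range n) ∧
      (∀ C, Covers G (Finset.range n) C → ∃ C', Covers G (runConfig G n 0 M b).set C' ∧
        C'.card + (runConfig G n 0 M b).cost ≤ C.card) ∧
      ∀ v ∈ (runConfig G n 0 M b).set, ¬ Reducible G (runConfig G n 0 M b).set v := by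
  have key (m : ℕ) : ∀ σ : Config, σ = (Config.step G 0 M)^[m] ⟨Finset.range n, 0, b⟩ →
      halfOpt G σ.set + 2 * σ.cost = halfOpt G (Finset.range n) ∧
      (∀ C, Covers G (Finset.range n) C → ∃ C', Covers G σ.set C' ∧
        C'.card + σ.cost ≤ C.card) ∧
      -- Every step before irreducibility removes a vertex, so `n` steps reach an irreducible,
      -- possibly empty, set.
      ((∀ v ∈ σ.set, ¬ Reducible G σ.set v) ∨ σ.set.card + m ≤ n) := by
    induction m with
    | zero =>
      rintro _ rfl
      exact ⟨rfl, fun C hC => ⟨C, hC, le_rfl⟩, .inr (by simp)⟩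
    | succ m ih =>
      rintro _ rfl
      obtain ⟨h1, h2, h3⟩ := ih _ rfl
      rw [Function.iterate_succ_apply']
      set σ := (Config.step G 0 M)^[m] ⟨Finset.range n, 0, b⟩
      obtain ⟨h4, h5, h6⟩ := step_zero_spec (G := G) (M := M) σ
      refine ⟨h4.trans h1, fun C hC => ?_, ?_⟩
      · obtain ⟨C₁, h7, h8⟩ := h2 C hC
        obtain ⟨C₂, h9, h10⟩ := h5 C₁ h7
        exact ⟨C₂, h9, h10.trans h8⟩
      · rcases h6 with ⟨h6, h7⟩ | h6
        · rw [h7]; exact .inl h6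
        · rcases h3 with h3 | h3
          · have : σ.step G 0 M = σ := step_of_irreducible h3 (.inl rfl)
            rw [this]; exact .inl h3
          · exact .inr (by omega)
  obtain ⟨h1, h2, h3⟩ := key n _ rfl
  refine ⟨h1, h2, h3.elim id fun h3 v hv => ?_⟩
  have := Finset.card_pos.2 ⟨v, hv⟩
  rw [runConfig] at this
  omega

end

/-! ### The complete program -/

/-- Set register 24 to `C` times the number of binary digits of register 1. -/
def thresholdProg (C : ℕ) : Prog :=
  .seq (.assign 26 (.const 1)) (.seq (.assign 24 (.const 0))
    (.loop (.sub (.add (.var 1) (.const 1)) (.var 26))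
      (.seq (.assign 26 (.add (.var 26) (.var 26))) (.assign 24 (.add (.var 24) (.const C))))))

/-- Register 26 runs through the powers of 2 until it exceeds `k`, which takes as many rounds as `k`
has digits. No register holds this count in advance, so the loop is not a `for` loop and its time,
14 per round and 6 for the last test, is counted directly. -/
theorem exec_threshold_loop (C m j : ℕ) (s : State) (h26 : s.var 26 = 2 ^ j)
    (h24 : s.var 24 = C * j) (hm : j + m = Nat.size (s.var 1)) :
    ∃ s', Exec (.loop (.sub (.add (.var 1) (.const 1)) (.var 26))
      (.seq (.assign 26 (.add (.var 26) (.var 26))) (.assign 24 (.add (.var 24) (.const C)))))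
        s (14 * m + 6) s' ∧ s'.var 24 = C * Nat.size (s.var 1) ∧ s'.arr = s.arr ∧
      ∀ y, y ≠ 24 → y ≠ 26 → s'.var y = s.var y := by
  induction m generalizing j s with
  | zero =>
    have h : ¬ 2 ^ j ≤ s.var 1 := by rw [← Nat.lt_size]; omega
    refine ⟨s, Exec.loop_false (by simp only [Expr.eval, h26]; omega), ?_, rfl,
      fun _ _ _ => rfl⟩
    rw [h24, ← hm, add_zero]
  | succ m ih =>
    have h : 2 ^ j ≤ s.var 1 := by rw [← Nat.lt_size]; omega
    have b1 := Exec.assign 26 (.add (.var 26) (.var 26)) s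
    have b2 := Exec.assign 24 (.add (.var 24) (.const C))
      (s.setVar 26 ((Expr.add (.var 26) (.var 26)).eval s))
    set s1 := (s.setVar 26 ((Expr.add (.var 26) (.var 26)).eval s)).setVar 24
      ((Expr.add (.var 24) (.const C)).eval
        (s.setVar 26 ((Expr.add (.var 26) (.var 26)).eval s))) with hs1
    have e1 : s1.var 1 = s.var 1 := by simp [hs1]
    obtain ⟨s', h1, h2, h3, h4⟩ := ih (j + 1) s1
      (by simp [hs1, Expr.eval, h26, pow_succ, mul_two])
      (by simp [hs1, Expr.eval, h24, mul_add]) (by rw [e1]; omega)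
    refine ⟨s', ?_, by rw [h2, e1], h3, fun y hy hy' => ?_⟩
    · have := Exec.loop_true (e := .sub (.add (.var 1) (.const 1)) (.var 26))
        (by simp only [Expr.eval, h26]; omega) (.seq b1 b2) h1
      convert this using 1
      simp only [Expr.cost]
      omega
    · rw [h4 y hy hy']
      simp [hs1, hy, hy']

theorem exec_thresholdProg (C : ℕ) (s : State) :
    ∃ s', Exec (thresholdProg C) s (14 * Nat.size (s.var 1) + 10) s' ∧
      s'.var 24 = C * Nat.size (s.var 1) ∧ s'.arr = s.arr ∧
      ∀ y, y ≠ 24 → y ≠ 26 → s'.var y = s.var y := by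
  obtain ⟨s', h1, h2, h3, h4⟩ := exec_threshold_loop C (Nat.size (s.var 1)) 0
    ((s.setVar 26 1).setVar 24 0) (by simp) (by simp) (by simp)
  refine ⟨s', ?_, by simpa using h2, h3, fun y hy hy' => ?_⟩
  · have := Exec.seq (Exec.assign 26 (.const 1) s)
      (.seq (Exec.assign 24 (.const 0) (s.setVar 26 1)) h1)
    rw [thresholdProg]
    convert this using 1
    simp only [Expr.cost]
    omega
  · rw [h4 y hy hy']
    simp [hy, hy']

/-- Set up the addresses of the rows of the adjacency matrix. -/
def rowProg : ForProg :=
  .seq (.assign 2 (.const 0)) (.seq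
    (.forLoop 0 4 (.seq (.store 1 (.var 4) (.var 2)) (.assign 2 (.add (.var 2) (.var 0)))))
    (.assign 2 (.add (.var 2) (.const 1))))

/-- Compute the value of the linear program and compare it with the threshold. -/
def compareProg : ForProg :=
  .seq (.forLoop 0 16 (.store 3 (.var 16) (.const 1))) (.seq auction
    (.seq (.assign 19 (.const 1)) (.seq (.assign 25 (.sub (.add (.var 1) (.var 1)) (.var 10)))
      (.ite (.sub (.add (.var 24) (.const 1)) (.var 25)) (.assign 20 (.const 1))
        (.seq (.assign 20 (.const 0)) (.assign 25 (.const 0)))))))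

/-- Compute the number of choices. -/
def powerProg : ForProg := .forLoop 25 29 (.assign 19 (.add (.var 19) (.var 19)))

/-- List the vertices that are left. -/
def listProg : ForProg :=
  .seq (.assign 30 (.const 0)) (.forLoop 0 4 (.ite (cell 2 4)
    (.seq (.store 6 (.var 30) (.var 4)) (.assign 30 (.add (.var 30) (.const 1)))) .skip))

/-- The new adjacency matrix, in array 7. -/
def matrixProg : ForProg :=
  .seq (.assign 31 (.const 0)) (.forLoop 30 4 (.forLoop 30 5
    (.seq (.store 7 (.var 31) (.get 0 (.add (.get 1 (cell 6 4)) (cell 6 5))))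
      (.assign 31 (.add (.var 31) (.const 1))))))

/-- Write the output. -/
def outputProg : ForProg :=
  .seq (.forLoop 31 32 (.store 0 (.var 32) (cell 7 32)))
    (.ite (.var 20)
      (.seq (.assign 1 (.const 0)) (.ite (.var 23) (.assign 0 (.const 0))
        (.seq (.assign 0 (.const 2)) (.seq (.store 0 (.const 0) (.const 0))
          (.seq (.store 0 (.const 1) (.const 1)) (.seq (.store 0 (.const 2) (.const 1))
            (.store 0 (.const 3) (.const 0))))))))
      (.seq (.assign 0 (.var 30)) (.assign 1 (.sub (.var 1) (.var 17)))))

/-- The kernelization. -/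
def kernelProg (C : ℕ) : Prog :=
  .seq (thresholdProg C) (.seq rowProg.compile (.seq compareProg.compile (.seq powerProg.compile
    (.seq searchProg.compile (.seq listProg.compile (.seq matrixProg.compile
      outputProg.compile))))))

section

variable {G : SimpleGraph ℕ} {n : ℕ} {s : State}

theorem run_rowProg (h0 : s.var 0 = n)
    (hadj : ∀ i < n, ∀ j < n, s.arr 0 (i * n + j) ≠ 0 ↔ G.Adj i j) :
    HoldsGraph G n (rowProg.run s) := by
  have hf := frame_run rowProg s
  have key := run_forLoop (r := 0) (x := 4) (s := (ForProg.assign 2 (.const 0)).run s)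
    (p := .seq (.store 1 (.var 4) (.var 2)) (.assign 2 (.add (.var 2) (.var 0)))) rfl
    (fun i s' => s'.var 2 = i * n ∧ ∀ j < i, s'.arr 1 j = j * n) ?_ ?_
  · have e : ((ForProg.assign 2 (.const 0)).run s).var 0 = n := h0
    rw [e] at key
    refine ⟨(hf.1 0 rfl).trans h0, ?_, key.2, ?_⟩
    · rw [rowProg, run_seq, run_seq]
      simpa [ForProg.run, Expr.eval] using key.1
    · rw [hf.2 0 rfl]
      exact hadj
  · simp [ForProg.run, Expr.eval]
  · intro i s' hi hx hf' ⟨h1, h2⟩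
    have e : s'.var 0 = n := (hf'.1 0 rfl).trans h0
    refine ⟨by simp [ForProg.run, Expr.eval, h1, e, add_mul], fun j hj => ?_⟩
    rcases Nat.lt_succ_iff_lt_or_eq.1 hj with hj' | rfl
    · simpa [ForProg.run, Expr.eval, hx, Function.update_apply, hj'.ne] using h2 j hj'
    · simp [ForProg.run, Expr.eval, hx, h1]

/-- Register 25 is the number of binary choices, namely twice the gap, and register 20 switches
branching on. Above the threshold both are 0, so the search degenerates to one run of pure
reduction. -/
theorem run_compareProg (hG : HoldsGraph G n s) :
    (compareProg.run s).var 19 = 1 ∧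
      ((2 * s.var 1 ≤ halfOpt G (Finset.range n) + s.var 24 ∧ (compareProg.run s).var 20 = 1 ∧
          (compareProg.run s).var 25 = 2 * s.var 1 - halfOpt G (Finset.range n)) ∨
        (halfOpt G (Finset.range n) + s.var 24 < 2 * s.var 1 ∧ (compareProg.run s).var 20 = 0 ∧
          (compareProg.run s).var 25 = 0)) ∧
      ∃ U f, IsDoubleMatching G (Finset.range n) U f ∧
        U.card = halfOpt G (Finset.range n) := by
  rw [compareProg, run_seq, run_seq, run_seq, run_seq]
  set s1 := (ForProg.forLoop 0 16 (.store 3 (.var 16) (.const 1))).run s with hs1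
  have hf1 : ForProg.Frame _ s s1 := frame_run _ s
  have hG1 := hG.frame hf1 rfl
  have h1 : HoldsSet (Finset.range n) n 3 s1 := by
    have key := run_forLoop (r := 0) (x := 16) (s := s) (p := .store 3 (.var 16) (.const 1)) rfl
      (fun i s' => ∀ w < i, s'.arr 3 w = 1) (by simp) ?_
    · rw [hG.order] at key
      exact fun w hw => by rw [key w hw, if_pos (Finset.mem_range.2 hw)]
    · intro i s' hi hx hf hI w hw
      rcases Nat.lt_succ_iff_lt_or_eq.1 hw with hw' | rfl
      · simpa [ForProg.run, Expr.eval, hx, Function.update_apply, hw'.ne] using hI w hw'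
      · simp [ForProg.run, Expr.eval, hx]
  obtain ⟨h10, hm⟩ := run_auction hG1 (fun u hu => Finset.mem_range.1 hu) h1
  set s2 := auction.run s1 with hs2
  have hf2 : auction.Frame s1 s2 := frame_run _ s1
  have c1 : s2.var 1 = s.var 1 := (hf2.1 1 rfl).trans (hf1.1 1 rfl)
  have c24 : s2.var 24 = s.var 24 := (hf2.1 24 rfl).trans (hf1.1 24 rfl)
  set s3 := (ForProg.assign 25 (.sub (.add (.var 1) (.var 1)) (.var 10))).run
    ((ForProg.assign 19 (.const 1)).run s2) with hs3
  have d25 : s3.var 25 = 2 * s.var 1 - halfOpt G (Finset.range n) := by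
    simp [hs3, ForProg.run, Expr.eval, h10, c1, two_mul]
  have d24 : s3.var 24 = s.var 24 := by simp [hs3, ForProg.run, c24]
  have d19 : s3.var 19 = 1 := by simp [hs3, ForProg.run, Expr.eval]
  by_cases h : 2 * s.var 1 ≤ halfOpt G (Finset.range n) + s.var 24
  · rw [run_ite_pos (by simp only [Expr.eval, d24, d25]; omega)]
    refine ⟨d19, .inl ⟨h, ?_, d25⟩, hm⟩
    simp [ForProg.run, Expr.eval]
  · rw [run_ite_neg (by simp only [Expr.eval, d24, d25]; omega)]
    refine ⟨d19, .inr ⟨by omega, ?_, ?_⟩, hm⟩ <;> simp [ForProg.run, Expr.eval]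

theorem run_powerProg (h19 : s.var 19 = 1) : (powerProg.run s).var 19 = 2 ^ s.var 25 := by
  refine run_forLoop (r := 25) (x := 29) (s := s) (p := .assign 19 (.add (.var 19) (.var 19))) rfl
    (fun i s' => s'.var 19 = 2 ^ i) (by simp [h19]) ?_
  intro i s' hi hx hf hI
  simp [ForProg.run, Expr.eval, hI, pow_succ, mul_two]

theorem run_listProg (h0 : s.var 0 = n) :
    (listProg.run s).var 30 = ((Finset.range n).filter (s.arr 2 · ≠ 0)).card ∧
      (∀ j < (listProg.run s).var 30,
        (listProg.run s).arr 6 j ∈ (Finset.range n).filter (s.arr 2 · ≠ 0)) ∧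
      ∀ i < (listProg.run s).var 30, ∀ j < (listProg.run s).var 30,
        (listProg.run s).arr 6 i = (listProg.run s).arr 6 j → i = j := by
  have key := run_forLoop (r := 0) (x := 4) (s := (ForProg.assign 30 (.const 0)).run s)
    (p := .ite (cell 2 4)
      (.seq (.store 6 (.var 30) (.var 4)) (.assign 30 (.add (.var 30) (.const 1)))) .skip) rfl
    (fun i s' => s'.var 30 = ((Finset.range i).filter (s.arr 2 · ≠ 0)).card ∧
      (∀ j < s'.var 30, s'.arr 6 j ∈ (Finset.range i).filter (s.arr 2 · ≠ 0)) ∧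
      ∀ a < s'.var 30, ∀ b < s'.var 30, s'.arr 6 a = s'.arr 6 b → a = b) ?_ ?_
  · have e : ((ForProg.assign 30 (.const 0)).run s).var 0 = n := h0
    rw [e] at key
    exact key
  · simp [ForProg.run, Expr.eval]
  · intro i s' hi hx hf ⟨h1, h2, h3⟩
    have e2 : s'.arr 2 = s.arr 2 := hf.2 2 rfl
    rw [Finset.range_add_one, Finset.filter_insert]
    by_cases h : s.arr 2 i = 0
    · rw [run_ite_neg (by simpa only [cell, Expr.eval, hx, e2] using h), if_neg (not_not.2 h)]
      exact ⟨h1, h2, h3⟩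
    · rw [run_ite_pos (by simpa only [cell, Expr.eval, hx, e2] using h), if_pos h,
        Finset.card_insert_of_notMem (by simp)]
      have hne : ∀ a < s'.var 30, s'.arr 6 a ≠ i := fun a ha e => by
        have := h2 a ha
        rw [e] at this
        simp at this
      have e6 (a : ℕ) : (((ForProg.seq (.store 6 (.var 30) (.var 4))
          (.assign 30 (.add (.var 30) (.const 1)))).run s').setVar 4 (i + 1)).arr 6 a =
          if a = s'.var 30 then i else s'.arr 6 a := by
        simp [ForProg.run, Expr.eval, hx, Function.update_apply]
      have e30 : (((ForProg.seq (.store 6 (.var 30) (.var 4))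
          (.assign 30 (.add (.var 30) (.const 1)))).run s').setVar 4 (i + 1)).var 30 =
          s'.var 30 + 1 := by simp [ForProg.run, Expr.eval]
      refine ⟨by rw [e30, h1], fun j hj => ?_, fun a ha b hb hab => ?_⟩
      · rw [e30] at hj
        rw [e6]
        split_ifs with h4
        · simp
        · exact Finset.mem_insert_of_mem (h2 j (by omega))
      · rw [e30] at ha hb
        rw [e6, e6] at hab
        split_ifs at hab with h4 h5 h5
        · omega
        · exact absurd hab.symm (hne b (by omega))
        · exact absurd hab (hne a (by omega))
        · exact h3 a (by omega) b (by omega) hab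

/-- A running address replaces the product `i * m`. The result goes to array 7 because array 0 is
still being read. -/
theorem run_matrixProg {m : ℕ} (h30 : s.var 30 = m) :
    (matrixProg.run s).var 31 = m * m ∧ ∀ i < m, ∀ j < m,
      (matrixProg.run s).arr 7 (i * m + j) = s.arr 0 (s.arr 1 (s.arr 6 i) + s.arr 6 j) := by
  suffices h : (matrixProg.run s).var 31 = m * m ∧ ∀ q < m * m, (matrixProg.run s).arr 7 q =
      s.arr 0 (s.arr 1 (s.arr 6 (q / m)) + s.arr 6 (q % m)) by
    refine ⟨h.1, fun i hi j hj => ?_⟩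
    rw [h.2 (i * m + j) (by nlinarith)]
    rw [mul_comm, Nat.mul_add_div (by omega), Nat.mul_add_mod, Nat.div_eq_of_lt hj,
      Nat.mod_eq_of_lt hj, add_zero]
  have key := run_forLoop (r := 30) (x := 4) (s := (ForProg.assign 31 (.const 0)).run s)
    (p := .forLoop 30 5
    (.seq (.store 7 (.var 31) (.get 0 (.add (.get 1 (cell 6 4)) (cell 6 5))))
      (.assign 31 (.add (.var 31) (.const 1))))) rfl
    (fun i s' => s'.var 31 = i * m ∧ ∀ q < i * m, s'.arr 7 q =
      s.arr 0 (s.arr 1 (s.arr 6 (q / m)) + s.arr 6 (q % m))) ?_ ?_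
  · have e : ((ForProg.assign 31 (.const 0)).run s).var 30 = m := h30
    rw [e] at key
    exact key
  · simp [ForProg.run, Expr.eval]
  · intro i s' hi hx hf ⟨h1, h2⟩
    have e30 : s'.var 30 = m := (hf.1 30 rfl).trans h30
    have inner := run_forLoop (r := 30) (x := 5) (s := s')
      (p := .seq (.store 7 (.var 31) (.get 0 (.add (.get 1 (cell 6 4)) (cell 6 5))))
        (.assign 31 (.add (.var 31) (.const 1)))) rfl
      (fun j s'' => s''.var 31 = i * m + j ∧ ∀ q < i * m + j, s''.arr 7 q =
        s.arr 0 (s.arr 1 (s.arr 6 (q / m)) + s.arr 6 (q % m))) ?_ ?_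
    · rw [e30] at inner
      rw [add_mul, one_mul]
      exact inner
    · simpa using ⟨h1, h2⟩
    · intro j s'' hj hx' hf' ⟨h3, h4⟩
      rw [e30] at hj
      have a4 : s''.var 4 = i := (hf'.1 4 rfl).trans hx
      have a0 : s''.arr 0 = s.arr 0 := (hf'.2 0 rfl).trans (hf.2 0 rfl)
      have a1 : s''.arr 1 = s.arr 1 := (hf'.2 1 rfl).trans (hf.2 1 rfl)
      have a6 : s''.arr 6 = s.arr 6 := (hf'.2 6 rfl).trans (hf.2 6 rfl)
      refine ⟨by simp [ForProg.run, Expr.eval, h3, add_assoc], fun q hq => ?_⟩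
      have e7 : (((ForProg.seq (.store 7 (.var 31) (.get 0 (.add (.get 1 (cell 6 4)) (cell 6 5))))
          (.assign 31 (.add (.var 31) (.const 1)))).run s'').setVar 5 (j + 1)).arr 7 q =
          if q = i * m + j then s.arr 0 (s.arr 1 (s.arr 6 i) + s.arr 6 j) else s''.arr 7 q := by
        simp [ForProg.run, cell, Expr.eval, h3, a4, hx', a0, a1, a6, Function.update_apply]
      rw [e7]
      split_ifs with h5
      · rw [h5, mul_comm, Nat.mul_add_div (by omega), Nat.mul_add_mod, Nat.div_eq_of_lt hj,
          Nat.mod_eq_of_lt hj, add_zero]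
      · exact h4 q (by omega)

theorem run_outputProg :
    (s.var 20 ≠ 0 → s.var 23 ≠ 0 →
      (outputProg.run s).var 0 = 0 ∧ (outputProg.run s).var 1 = 0) ∧
    (s.var 20 ≠ 0 → s.var 23 = 0 →
      (outputProg.run s).var 0 = 2 ∧ (outputProg.run s).var 1 = 0 ∧
        (outputProg.run s).arr 0 0 = 0 ∧ (outputProg.run s).arr 0 1 = 1 ∧
        (outputProg.run s).arr 0 2 = 1 ∧ (outputProg.run s).arr 0 3 = 0) ∧
    (s.var 20 = 0 → (outputProg.run s).var 0 = s.var 30 ∧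
      (outputProg.run s).var 1 = s.var 1 - s.var 17 ∧
      ∀ q < s.var 31, (outputProg.run s).arr 0 q = s.arr 7 q) := by
  rw [outputProg, run_seq]
  set s1 := (ForProg.forLoop 31 32 (.store 0 (.var 32) (cell 7 32))).run s with hs1
  have hf1 : ForProg.Frame _ s s1 := frame_run _ s
  have h1 : ∀ q < s.var 31, s1.arr 0 q = s.arr 7 q := by
    refine run_forLoop (r := 31) (x := 32) (s := s) (p := .store 0 (.var 32) (cell 7 32)) rfl
      (fun i s' => ∀ q < i, s'.arr 0 q = s.arr 7 q) (by simp) ?_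
    intro i s' hi hx hf hI q hq
    have e7 : s'.arr 7 = s.arr 7 := hf.2 7 rfl
    rcases Nat.lt_succ_iff_lt_or_eq.1 hq with hq' | rfl
    · simpa [ForProg.run, cell, Expr.eval, hx, Function.update_apply, hq'.ne] using hI q hq'
    · simp [ForProg.run, cell, Expr.eval, hx, e7]
  have c (r : ℕ) (h : r ≠ 32) : s1.var r = s.var r :=
    hf1.1 r (by simp [ForProg.writesVar, h.symm])
  have c20 := c 20 (by omega)
  have c23 := c 23 (by omega)
  refine ⟨fun h2 h3 => ?_, fun h2 h3 => ?_, fun h2 => ?_⟩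
  · rw [run_ite_pos (by simpa only [Expr.eval, c20] using h2), run_seq,
      run_ite_pos (by simpa [ForProg.run, Expr.eval, c23] using h3)]
    simp [ForProg.run, Expr.eval]
  · rw [run_ite_pos (by simpa only [Expr.eval, c20] using h2), run_seq,
      run_ite_neg (by simpa [ForProg.run, Expr.eval, c23] using h3)]
    simp [ForProg.run, Expr.eval]
  · rw [run_ite_neg (by simpa only [Expr.eval, c20] using h2)]
    refine ⟨?_, ?_, h1⟩
    · simp [ForProg.run, Expr.eval, c 30 (by omega)]
    · simp [ForProg.run, Expr.eval, c 1 (by omega), c 17 (by omega)]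

end

/-! ### Correctness and running time of the complete program -/

section

/-- The memory after the execution of the part of the kernelization that follows the computation
of the threshold. -/
def kernelState (s : State) : State :=
  outputProg.run (matrixProg.run (listProg.run (searchProg.run (powerProg.run (compareProg.run
    (rowProg.run s))))))

/-- The graph of an instance, with additional isolated vertices. -/
def Instance.graph (I : Instance) : SimpleGraph ℕ := I.G.map Fin.valEmbedding

theorem Instance.comap_graph (I : Instance) : I.graph.comap Fin.valEmbedding = I.G :=
  SimpleGraph.comap_map_eq _ _

theorem Instance.graph_adj (I : Instance) (i j : Fin I.n) : I.graph.Adj i j ↔ I.G.Adj i j := by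
  conv_rhs => rw [← I.comap_graph]
  rfl

theorem map_valEmbedding_univ (n : ℕ) :
    (Finset.univ : Finset (Fin n)).map Fin.valEmbedding = Finset.range n := by
  ext w
  simp only [Finset.mem_map, Finset.mem_univ, true_and, Finset.mem_range]
  exact ⟨fun ⟨a, ha⟩ => ha ▸ a.2, fun h => ⟨⟨w, h⟩, rfl⟩⟩

theorem Instance.isYes_iff (I : Instance) :
    I.IsYes ↔ ∃ C, Covers I.graph (Finset.range I.n) C ∧ C.card ≤ I.k := by
  rw [← map_valEmbedding_univ, ← isVertexCover_comap_iff, I.comap_graph]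
  rfl

open Classical in
theorem Instance.input_arr (I : Instance) {i j : ℕ} (hi : i < I.n) (hj : j < I.n) :
    I.input.arr 0 (i * I.n + j) = if I.graph.Adj i j then 1 else 0 := by
  have h : (∃ a b : Fin I.n, I.G.Adj a b ∧ i * I.n + j = a * I.n + b) ↔ I.graph.Adj i j := by
    constructor
    · rintro ⟨a, b, hab, e⟩
      have hdiv {x y : ℕ} (hy : y < I.n) : (x * I.n + y) / I.n = x ∧ (x * I.n + y) % I.n = y := by
        rw [mul_comm, Nat.mul_add_div (by omega), Nat.mul_add_mod, Nat.div_eq_of_lt hy,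
          Nat.mod_eq_of_lt hy, add_zero]
        exact ⟨rfl, rfl⟩
      have h1 := hdiv (x := i) hj
      have h2 := hdiv (x := a) b.2
      rw [e] at h1
      rw [← h1.1, ← h1.2, h2.1, h2.2]
      exact (I.graph_adj a b).2 hab
    · intro h
      exact ⟨⟨i, hi⟩, ⟨j, hj⟩, (I.graph_adj ⟨i, hi⟩ ⟨j, hj⟩).1 h, rfl⟩
  simp only [Instance.input, true_and, h]

theorem two_pow_size_le (k : ℕ) : 2 ^ Nat.size k ≤ 2 * k + 1 := by
  rcases h : Nat.size k with _ | m
  · simp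
  · have : 2 ^ m ≤ k := Nat.lt_size.1 (by omega)
    rw [pow_succ]
    omega

variable {C : ℕ} {I : Instance} {s : State}

theorem holdsGraph_rowProg (h0 : s.var 0 = I.n) (ha : s.arr = I.input.arr) :
    HoldsGraph I.graph I.n (rowProg.run s) := by
  refine run_rowProg h0 fun i hi j hj => ?_
  rw [ha, I.input_arr hi hj]
  split_ifs with h <;> simp [h]

/-- The number of choices is polynomial. -/
theorem bounds_kernel (h0 : s.var 0 = I.n) (h1 : s.var 1 = I.k)
    (h24 : s.var 24 = C * Nat.size I.k) (ha : s.arr = I.input.arr) :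
    (compareProg.run (rowProg.run s)).var 25 ≤ C * Nat.size I.k ∧
      (powerProg.run (compareProg.run (rowProg.run s))).var 19 ≤
        (I.n + C * Nat.size I.k + 1) ^ C := by
  obtain ⟨h2, h3, -⟩ := run_compareProg (holdsGraph_rowProg h0 ha)
  rw [run_powerProg h2]
  rw [var_run (p := rowProg) rfl, var_run (p := rowProg) rfl, h1, h24] at h3
  have h4 := halfOpt_le_card I.graph (Finset.range I.n)
  rw [Finset.card_range] at h4
  -- In general `k` is not polynomial in the input size. In the branching case it is: `2 * k` is at
  -- most the optimum plus the threshold, hence at most `n` plus the threshold.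
  rcases h3 with ⟨h3, -, h5⟩ | ⟨-, -, h5⟩
  · refine ⟨by omega, ?_⟩
    calc 2 ^ (compareProg.run (rowProg.run s)).var 25
        ≤ 2 ^ (Nat.size I.k * C) := Nat.pow_le_pow_right (by omega) (by rw [mul_comm]; omega)
      _ = (2 ^ Nat.size I.k) ^ C := pow_mul _ _ _
      _ ≤ _ := Nat.pow_le_pow_left (by have := two_pow_size_le I.k; omega) C
  · rw [h5, pow_zero]
    exact ⟨Nat.zero_le _, Nat.one_le_pow _ _ (by omega)⟩

/-- Strong duality is extracted from the correctness of the auction, run hypothetically on a memory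
in which array `a` has been copied to array 3. -/
theorem exists_doubleMatching {G : SimpleGraph ℕ} {S : Finset ℕ} {n a : ℕ}
    (hG : HoldsGraph G n s) (hS : ∀ u ∈ S, u < n) (hA : HoldsSet S n a s) :
    ∃ U f, IsDoubleMatching G S U f ∧ U.card = halfOpt G S :=
  (run_auction (s := ⟨s.var, Function.update s.arr 3 (s.arr a)⟩)
    (hG.congr rfl rfl (by simp) (by simp)) hS
    (by
      change ∀ w < n, Function.update s.arr 3 (s.arr a) 3 w = _
      rw [Function.update_self]
      exact hA)).2

/-- An instance that is trivial to solve. -/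
def Instance.Solved (J : Instance) : Prop := J.n ≤ 2 ∧ J.k = 0

/-- The last part of the program, when the instance has not been solved. -/
theorem run_output_reduced {τ : Config} (hG : HoldsGraph I.graph I.n s)
    (hτ : HoldsConfig τ I.n s) (h20 : s.var 20 = 0) (ha : s.arr 0 = I.input.arr 0) :
    ∃ (m : ℕ) (g : Fin m ↪ ℕ), Finset.univ.map g = τ.set ∧
      (⟨m, I.graph.comap g, s.var 1 - τ.cost⟩ : Instance).IsOutput
        (outputProg.run (matrixProg.run (listProg.run s))) := by
  classical
  obtain ⟨l1, l2, l3⟩ := run_listProg hG.order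
  have hf5 := frame_run listProg s
  generalize listProg.run s = s5 at l1 l2 l3 hf5 ⊢
  have hset : (Finset.range I.n).filter (s.arr 2 · ≠ 0) = τ.set := by
    ext w
    simp only [Finset.mem_filter, Finset.mem_range]
    refine ⟨fun ⟨hw, h⟩ => by_contra fun h' => h ?_, fun h => ⟨hτ.mem_lt w h, ?_⟩⟩
    · rw [hτ.set w hw, if_neg h']
    · rw [hτ.set w (hτ.mem_lt w h), if_pos h]
      exact one_ne_zero
  rw [hset] at l1 l2
  obtain ⟨m1, m2⟩ := run_matrixProg (s := s5) l1
  have hf6 := frame_run matrixProg s5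
  generalize matrixProg.run s5 = s6 at m1 m2 hf6 ⊢
  rw [l1] at l2 l3
  generalize hm : τ.set.card = m at l1 l2 l3 m1 m2
  let g : Fin m ↪ ℕ := ⟨fun i => s5.arr 6 i, fun i j h => Fin.ext (l3 i i.2 j j.2 h)⟩
  have hg : Finset.univ.map g = τ.set := by
    refine Finset.eq_of_subset_of_card_le (fun w hw => ?_) (by
      rw [hm, Finset.card_map, Finset.card_univ, Fintype.card_fin])
    obtain ⟨i, -, rfl⟩ := Finset.mem_map.1 hw
    exact l2 i i.2
  have e (r : ℕ) (h : matrixProg.writesVar r = false) (h' : listProg.writesVar r = false) :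
      s6.var r = s.var r := (hf6.1 r h).trans (hf5.1 r h')
  obtain ⟨q0, q1, q2⟩ := run_outputProg.2.2 ((e 20 rfl rfl).trans h20)
  refine ⟨m, g, hg, ?_, ?_, fun i j => ?_⟩
  · rw [q0, hf6.1 30 rfl, l1]
  · rw [q1, e 1 rfl rfl, e 17 rfl rfl, hτ.cost]
  · have hi := hτ.mem_lt _ (l2 i i.2)
    have hj := hτ.mem_lt _ (l2 j j.2)
    have hij : (i : ℕ) * m + j < m * m := by
      have h2 : (i : ℕ) + 1 ≤ m := i.2
      have h3 : (j : ℕ) < m := j.2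
      calc (i : ℕ) * m + j < (i + 1) * m := by rw [add_mul, one_mul]; omega
        _ ≤ m * m := Nat.mul_le_mul_right m h2
    rw [q2 _ (by rw [m1]; exact hij), m2 i i.2 j j.2, hf5.2 1 rfl, hf5.2 0 rfl, ha, hG.row _ hi,
      I.input_arr hi hj]
    rfl

/-- The last part of the program, when the instance has been solved. -/
theorem run_output_solved (h20 : s.var 20 ≠ 0) (hfound : s.var 23 ≠ 0 ↔ I.IsYes) :
    ∃ J : Instance, J.IsOutput (outputProg.run (matrixProg.run (listProg.run s))) ∧
      (I.IsYes ↔ J.IsYes) ∧ J.Solved := by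
  have hf5 := frame_run listProg s
  generalize listProg.run s = s5 at hf5 ⊢
  have hf6 := frame_run matrixProg s5
  generalize matrixProg.run s5 = s6 at hf6 ⊢
  have e20 : s6.var 20 = s.var 20 := (hf6.1 20 rfl).trans (hf5.1 20 rfl)
  have e23 : s6.var 23 = s.var 23 := (hf6.1 23 rfl).trans (hf5.1 23 rfl)
  obtain ⟨o1, o2, -⟩ := run_outputProg (s := s6)
  by_cases hyes : I.IsYes
  · obtain ⟨q0, q1⟩ := o1 (by rwa [e20]) (by rw [e23]; exact hfound.2 hyes)
    exact ⟨⟨0, ⊥, 0⟩, ⟨q0, q1, fun i => i.elim0⟩,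
      iff_of_true hyes ⟨∅, fun i => i.elim0, le_rfl⟩, Nat.zero_le _, rfl⟩
  · obtain ⟨q0, q1, q2, q3, q4, q5⟩ := o2 (by rwa [e20])
      (by rw [e23]; exact not_not.1 (mt hfound.1 hyes))
    -- A single edge with budget 0 is the standard no-instance; it accounts for the 2 in the size
    -- bound.
    refine ⟨⟨2, ⊤, 0⟩, ⟨q0, q1, fun i j => ?_⟩, iff_of_false hyes ?_, le_rfl, rfl⟩
    · change Fin 2 at i j
      fin_cases i <;> fin_cases j <;> simp [q2, q3, q4, q5]
    · rintro ⟨T, hT, hc⟩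
      obtain rfl : T = ∅ := Finset.card_eq_zero.1 (Nat.le_zero.1 hc)
      have := hT (v := (0 : Fin 2)) (w := (1 : Fin 2)) (by simp)
      simp at this

/-- The output of the program has the desired properties. -/
theorem kernelState_spec (h0 : s.var 0 = I.n) (h1 : s.var 1 = I.k)
    (h24 : s.var 24 = C * Nat.size I.k) (ha : s.arr = I.input.arr) :
    ∃ J : Instance, J.IsOutput (kernelState s) ∧ (I.IsYes ↔ J.IsYes) ∧ J.k ≤ I.k ∧
      ((I.k : ℝ) - vcStar I.G ≤ (C * Nat.size I.k : ℕ) / 2 → J.Solved) ∧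
      (J.Solved ∨ (UniqueHalf J.G ∧ (J.n : ℝ) = 2 * vcStar J.G ∧
        ((C * Nat.size I.k : ℕ) : ℝ) / 2 < (J.k : ℝ) - vcStar J.G)) := by
  classical
  rw [kernelState]
  have hG1 := holdsGraph_rowProg h0 ha
  have hf1 := frame_run rowProg s
  generalize rowProg.run s = s1 at hG1 hf1 ⊢
  obtain ⟨c19, c25, U, f, hm, hU⟩ := run_compareProg hG1
  have hf2 := frame_run compareProg s1
  generalize compareProg.run s1 = s2 at c19 c25 hf2 ⊢
  have p19 := run_powerProg c19
  have hf3 := frame_run powerProg s2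
  generalize powerProg.run s2 = s3 at p19 hf3 ⊢
  have hG3 : HoldsGraph I.graph I.n s3 := (hG1.frame hf2 rfl).frame hf3 rfl
  obtain ⟨hsearch, hconf⟩ := run_searchProg hG3
  have hf4 := frame_run searchProg s3
  generalize searchProg.run s3 = s4 at hsearch hconf hf4 ⊢
  have hG4 : HoldsGraph I.graph I.n s4 := hG3.frame hf4 rfl
  have hvc : vcStar I.G = (halfOpt I.graph (Finset.range I.n) : ℝ) / 2 := by
    rw [← map_valEmbedding_univ] at hm hU ⊢
    rw [← vcStar_comap hm hU, I.comap_graph]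
  rw [hf1.1 1 rfl, hf1.1 24 rfl, h1, h24] at c25
  have d20 : s3.var 20 = s2.var 20 := hf3.1 20 rfl
  have d1 : s3.var 1 = I.k := by rw [hf3.1 1 rfl, hf2.1 1 rfl, hf1.1 1 rfl, h1]
  have e20 : s4.var 20 = s2.var 20 := (hf4.1 20 rfl).trans d20
  have e1 : s4.var 1 = I.k := (hf4.1 1 rfl).trans d1
  rcases c25 with ⟨hle, c20, c25⟩ | ⟨hlt, c20, c25⟩
  · rw [d20, d1, p19, c25, c20, exists_runConfig_iff one_ne_zero (by omega),
      ← I.isYes_iff] at hsearch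
    obtain ⟨J, hJ, hyes, hs⟩ := run_output_solved (by omega) hsearch
    exact ⟨J, hJ, hyes, hs.2 ▸ Nat.zero_le _, fun _ => hs, .inl hs⟩
  · rw [d20, p19, c25, c20] at hconf
    replace hconf := hconf (pow_zero 2)
    rw [pow_zero] at hconf
    obtain ⟨r1, r2, r3⟩ := runConfig_zero (G := I.graph) I.n 1 0
    have r4 : ∀ D, Covers I.graph (runConfig I.graph I.n 0 1 0).set D →
        ∃ D', Covers I.graph (Finset.range I.n) D' ∧
          D'.card + 0 ≤ D.card + (runConfig I.graph I.n 0 1 0).cost :=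
      fun D hD => exists_covers_of_iterate I.n hD
    generalize runConfig I.graph I.n 0 1 0 = τ at hconf r1 r2 r3 r4
    obtain ⟨U', f', hm', hU'⟩ := exists_doubleMatching hG4 hconf.mem_lt hconf.set
    obtain ⟨m, g, hg, hout⟩ := run_output_reduced hG4 hconf (by rw [e20, c20])
      (by rw [hf4.2 0 rfl, hf3.2 0 rfl, hf2.2 0 rfl, hf1.2 0 rfl, ha])
    rw [e1] at hout
    -- Twice the cost is at most the original optimum by `r1`, and that is below `2 * k`. Hence the
    -- subtraction in the new budget is not truncated.
    have hcost : τ.cost ≤ I.k := by omega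
    have hcard : m = τ.set.card := by
      rw [← hg, Finset.card_map, Finset.card_univ, Fintype.card_fin]
    have hJvc : vcStar (I.graph.comap g) = (halfOpt I.graph τ.set : ℝ) / 2 := by
      rw [vcStar_comap (hg.symm ▸ hm') (hg.symm ▸ hU'), hg]
    have hr1 : (halfOpt I.graph τ.set : ℝ) + 2 * τ.cost = halfOpt I.graph (Finset.range I.n) := by
      exact_mod_cast r1
    have hlt' : (halfOpt I.graph (Finset.range I.n) : ℝ) + (C * Nat.size I.k : ℕ) < 2 * I.k := by
      exact_mod_cast hlt
    refine ⟨_, hout, ?_, Nat.sub_le _ _, fun h => ?_, .inr ⟨?_, ?_, ?_⟩⟩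
    · rw [I.isYes_iff]
      change _ ↔ ∃ S : Finset (Fin m), (I.graph.comap g).IsVertexCover (S : Set (Fin m)) ∧
        S.card ≤ I.k - τ.cost
      rw [isVertexCover_comap_iff, hg]
      constructor
      · rintro ⟨D, hD, hk⟩
        obtain ⟨D', h2, h3⟩ := r2 D hD
        exact ⟨D', h2, by omega⟩
      · rintro ⟨D, hD, hk⟩
        obtain ⟨D', h2, h3⟩ := r4 D hD
        exact ⟨D', h2, by omega⟩
    -- A gap within the threshold contradicts `hlt'`.
    · rw [hvc] at h
      linarith
    · exact uniqueHalf_comap (hg.symm ▸ r3) (hg.symm ▸ hm') (hg.symm ▸ hU')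
    · change (m : ℝ) = 2 * vcStar (I.graph.comap g)
      rw [hJvc, halfOpt_eq_card r3, hcard]
      ring
    -- By `r1` the budget and the LP value have both dropped by `τ.cost`, so the new gap is the old
    -- one.
    · change _ < ((I.k - τ.cost : ℕ) : ℝ) - vcStar (I.graph.comap g)
      rw [hJvc, Nat.cast_sub hcost]
      linarith

/-- An upper bound on the registers that bound the loops of the kernelization. -/
noncomputable def loopBound (C : ℕ) : Polynomial ℕ :=
  Polynomial.X ^ 2 + Polynomial.X + 1 + Polynomial.C C * Polynomial.X +
    (Polynomial.C (C + 1) * Polynomial.X + 1) ^ C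

/-- An upper bound on the number of steps of the kernelization. -/
noncomputable def kernelTime (C : ℕ) : Polynomial ℕ :=
  14 * Polynomial.X + 10 + (rowProg.time + compareProg.time + powerProg.time + searchProg.time +
    listProg.time + matrixProg.time + outputProg.time).comp (loopBound C)

/-- Every loop is bounded by `n`, by `n * n + 1`, by the number of choices or of choice sequences,
or by the order of the kernel or its square. All are below `loopBound C` at the input size. -/
theorem exec_kernelProg (C : ℕ) (I : Instance) :
    ∃ t s s', s.var 0 = I.n ∧ s.var 1 = I.k ∧ s.var 24 = C * Nat.size I.k ∧
      s.arr = I.input.arr ∧ s' = kernelState s ∧ Exec (kernelProg C) I.input t s' ∧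
      t ≤ (kernelTime C).eval I.size := by
  obtain ⟨s, hex, h24, ha, hfr⟩ := exec_thresholdProg C I.input
  have hk : I.input.var 1 = I.k := rfl
  rw [hk] at hex h24
  have h0 : s.var 0 = I.n := hfr 0 (by omega) (by omega)
  have h1 : s.var 1 = I.k := hfr 1 (by omega) (by omega)
  obtain ⟨b25, b19⟩ := bounds_kernel h0 h1 h24 ha
  have hG1 := holdsGraph_rowProg h0 ha
  set B := (loopBound C).eval I.size with hB
  have hBeq : B = I.size ^ 2 + I.size + 1 + C * I.size + ((C + 1) * I.size + 1) ^ C := by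
    simp [hB, loopBound]
  have hn : I.n ≤ I.size := Nat.le_add_right _ _
  have hsz : Nat.size I.k ≤ I.size := Nat.le_add_left _ _
  have hC : C * Nat.size I.k ≤ C * I.size := Nat.mul_le_mul_left _ hsz
  have hpow : (I.n + C * Nat.size I.k + 1) ^ C ≤ ((C + 1) * I.size + 1) ^ C :=
    Nat.pow_le_pow_left (by rw [add_mul, one_mul]; omega) C
  have hsq : I.n * I.n ≤ I.size ^ 2 := by rw [sq]; exact Nat.mul_le_mul hn hn
  set s1 := rowProg.run s with hs1
  set s2 := compareProg.run s1 with hs2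
  set s3 := powerProg.run s2 with hs3
  have hG2 : HoldsGraph I.graph I.n s2 := hG1.frame (frame_run compareProg s1) rfl
  have hG3 : HoldsGraph I.graph I.n s3 := hG2.frame (frame_run powerProg s2) rfl
  set s4 := searchProg.run s3 with hs4
  have hG4 : HoldsGraph I.graph I.n s4 := hG3.frame (frame_run searchProg s3) rfl
  have l1 := (run_listProg hG4.order).1
  set s5 := listProg.run s4 with hs5
  have hcard : s5.var 30 ≤ I.n := by
    rw [l1]
    exact (Finset.card_filter_le _ _).trans (Finset.card_range _).le
  have m1 := (run_matrixProg (s := s5) rfl).1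
  set s6 := matrixProg.run s5 with hs6
  have hm : s5.var 30 * s5.var 30 ≤ I.n * I.n := Nat.mul_le_mul hcard hcard
  obtain ⟨t1, ht1, x1⟩ := exec_compile rowProg s B rfl fun r hr => by
    obtain rfl : r = 0 := by simpa [rowProg, ForProg.bounds] using hr
    exact ⟨rfl, by omega⟩
  obtain ⟨t2, ht2, x2⟩ := exec_compile compareProg s1 B rfl fun r hr => by
    obtain rfl | rfl : r = 0 ∨ r = 2 :=
      (by decide : ∀ r ∈ compareProg.bounds, r = 0 ∨ r = 2) r hr
    exacts [⟨rfl, by rw [hG1.order]; omega⟩, ⟨rfl, by rw [hG1.rounds]; omega⟩]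
  obtain ⟨t3, ht3, x3⟩ := exec_compile powerProg s2 B rfl fun r hr => by
    obtain rfl : r = 25 := by simpa [powerProg, ForProg.bounds] using hr
    exact ⟨rfl, by omega⟩
  obtain ⟨t4, ht4, x4⟩ := exec_compile searchProg s3 B rfl fun r hr => by
    obtain rfl | rfl | rfl : r = 0 ∨ r = 2 ∨ r = 19 :=
      (by decide : ∀ r ∈ searchProg.bounds, r = 0 ∨ r = 2 ∨ r = 19) r hr
    exacts [⟨rfl, by rw [hG3.order]; omega⟩, ⟨rfl, by rw [hG3.rounds]; omega⟩,
      ⟨rfl, by omega⟩]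
  obtain ⟨t5, ht5, x5⟩ := exec_compile listProg s4 B rfl fun r hr => by
    obtain rfl : r = 0 := by simpa [listProg, ForProg.bounds] using hr
    exact ⟨rfl, by rw [hG4.order]; omega⟩
  obtain ⟨t6, ht6, x6⟩ := exec_compile matrixProg s5 B rfl fun r hr => by
    obtain rfl : r = 30 := by simpa [matrixProg, ForProg.bounds] using hr
    exact ⟨rfl, by omega⟩
  obtain ⟨t7, ht7, x7⟩ := exec_compile outputProg s6 B rfl fun r hr => by
    obtain rfl : r = 31 := by simpa [outputProg, ForProg.bounds] using hr
    exact ⟨rfl, by omega⟩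
  refine ⟨_, s, _, h0, h1, h24, ha, rfl,
    hex.seq (x1.seq (x2.seq (x3.seq (x4.seq (x5.seq (x6.seq x7)))))), ?_⟩
  simp only [kernelTime, Polynomial.eval_add, Polynomial.eval_mul, Polynomial.eval_X,
    Polynomial.eval_ofNat, Polynomial.eval_comp, ← hB]
  omega

theorem logb_le_size {k : ℕ} (hk : 1 ≤ k) : Real.logb 2 k ≤ Nat.size k := by
  rw [Real.logb_le_iff_le_rpow one_lt_two (by exact_mod_cast hk), Real.rpow_natCast]
  exact_mod_cast (Nat.lt_size_self k).le

end
end VCKernel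

/-! ### The kernelization theorem -/

theorem mainTheorem11 (c : ℝ) :
    ∃ f : VCKernel.Instance → VCKernel.Instance,
      VCKernel.PolyTimeComputable f ∧
      ∀ I : VCKernel.Instance, 1 ≤ I.k →
        (I.IsYes ↔ (f I).IsYes) ∧
        (f I).k ≤ I.k ∧
        ((f I).n : ℝ) ≤ max 2 (2 * (I.k : ℝ) - c * Real.logb 2 I.k) ∧
        ((I.k : ℝ) - VCKernel.vcStar I.G ≤ c / 2 * Real.logb 2 I.k →
          (f I).n ≤ 2 ∧ (f I).k = 0) ∧
        (((f I).n ≤ 2 ∧ (f I).k = 0) ∨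
          (VCKernel.UniqueHalf (f I).G ∧
            ((f I).n : ℝ) = 2 * VCKernel.vcStar (f I).G ∧
            c / 2 * Real.logb 2 I.k < ((f I).k : ℝ) - VCKernel.vcStar (f I).G)) := by
  obtain ⟨C, hC⟩ := exists_nat_ge |c|
  choose t s s' h0 h1 h24 ha hs' hex ht using VCKernel.exec_kernelProg C
  choose f hout hyes hk hsolved hbig using
    fun I => VCKernel.kernelState_spec (h0 I) (h1 I) (h24 I) (ha I)
  refine ⟨f, ⟨VCKernel.kernelProg C, VCKernel.kernelTime C, fun I =>
    ⟨t I, s' I, hex I, ht I, hs' I ▸ hout I⟩⟩, fun I hI => ?_⟩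
  -- The program uses an integer threshold at least as large as the required one, so it may solve
  -- more instances than demanded, and the kernels that remain have a larger gap. As `k ≥ 1`, the
  -- logarithm is nonnegative, and negative `c` is covered too.
  have hlog : c / 2 * Real.logb 2 I.k ≤ ((C * Nat.size I.k : ℕ) : ℝ) / 2 := by
    have h2 : 0 ≤ Real.logb 2 I.k := Real.logb_nonneg one_lt_two (by exact_mod_cast hI)
    have h3 := VCKernel.logb_le_size hI
    have h4 : c * Real.logb 2 I.k ≤ C * (Nat.size I.k : ℝ) :=
      mul_le_mul ((le_abs_self c).trans hC) h3 h2 (Nat.cast_nonneg C)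
    push_cast
    linarith
  refine ⟨hyes I, hk I, ?_, fun h => hsolved I (h.trans hlog), ?_⟩
  · rcases hbig I with h | ⟨-, h, h'⟩
    · exact le_max_of_le_left (by exact_mod_cast h.1)
    · refine le_max_of_le_right ?_
      have : ((f I).k : ℝ) ≤ I.k := by exact_mod_cast hk I
      linarith
  · exact (hbig I).imp id fun ⟨h2, h3, h4⟩ => ⟨h2, h3, hlog.trans_lt h4⟩
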